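/- Let $I,K$ be symmetric real $3\times3$ matrices (for instance inertia tensors), identify $(\mathfrak{so}(3),[\cdot,\cdot])$ with $(\mathbb R^3,\times)$, let $\mathbb T^3=S^1\times S^1\times S^1$ and $Q=SO(3)\times\mathbb T^3$, and let $L:TQ\to\mathbb R$ be the Lagrangian of the free rigid body with rotors, $$L(R,\theta,\dot R,\dot\theta)=\tfrac12\langle\Omega,I\Omega\rangle+\tfrac12\langle\Omega+\dot\theta,K(\Omega+\dot\theta)\rangle,\qquad \Omega=R^{-1}\dot R .$$ A Lagrange–Poincaré (LP) bundle is a sum $TM\oplus V\to M$ with a fibrewise Lie bracket, a $V$-valued 2-form $\omega$ and a linear connection $\nabla$ on $V$ such that $$[X_1\oplus w_1,X_2\oplus w_2]=[X_1,X_2]\oplus(\nabla_{X_1}w_2-\nabla_{X_2}w_1-\omega(X_1,X_2)+[w_1,w_2])$$ satisfies the Jacobi identity on sections. The LP equations of $l:TM\oplus V\to\mathbb R$ are the vertical one, $\frac{D}{dt}\frac{\partial l}{\partial v}=\mathrm{ad}^*_v\frac{\partial l}{\partial v}$, and the horizontal one, $\frac{\partial l}{\partial q}-\frac{D}{dt}\frac{\partial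 l}{\partial\dot q}=\langle\frac{\partial l}{\partial v},\omega(\dot q,\cdot)\rangle$, where $\langle\mathrm{ad}^*_vp,w\rangle=\langle p,[v,w]\rangle$. Derivatives with respect to vectors of $\mathbb R^3$ are identified with vectors by the scalar product. **First step.** $SO(3)$ acts freely on $Q$ by left translation of the first factor, its orbits are the fibres of $Q\to\mathbb T^3$, and $A(\dot R,\dot\theta)=\mathrm{Ad}_R(R^{-1}\dot R)=\dot RR^{-1}$ (the Maurer–Cartan form) is a principal connection with zero curvature. The map $(R,\theta,\dot R,\dot\theta)\mapsto(\theta,\dot\theta,[(R,\theta),A(\dot R,\dot\theta)])$ induces a bijection $TQ/SO(3)\to T\mathbb T^3\oplus\widetilde{\mathfrak{so}}(3)$, and the trivialization $[(R,\theta),\xi]\mapsto(\theta,\mathrm{Ad}_{R^{-1}}\xi)$ of the adjoint bundle turns it into $[R,\theta,\dot R,\dot\theta]\mapsto(\theta,\dot\theta,\Omega)\in T\mathbb T^3\oplus(\mathbb T^3\times\mathfrak{so}(3))$. In this trivialization the structure induced by $A$ (the fibrewise bracket, $\tilde B$ and $\nabla^A$) consists of the cross product, the zero 2-form and the trivial covariant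 derivative, and it is an LP bundle. $L$ is $SO(3)$-invariant and drops to exactly one function, the coupled reduced Lagrangian $$l_{1,O}(\theta,\dot\theta,\Omega)=\tfrac12\langle\Omega,(I+K)\Omega\rangle+\tfrac12\langle\dot\theta,K\dot\theta\rangle+\langle\Omega,K\dot\theta\rangle .$$ For every curve $(\theta(t),\dot\theta(t),\Omega(t))$ in $T\mathbb T^3\oplus(\mathbb T^3\times\mathfrak{so}(3))$ with $\dot\theta$ the velocity of $\theta$ and $\dot\theta,\Omega$ differentiable, the vertical LP equation of $l_{1,O}$ is equivalent to $$(I+K)\dot\Omega+K\ddot\theta=((I+K)\Omega+K\dot\theta)\times\Omega\qquad(1)$$ and the horizontal one to $$K\ddot\theta+K\dot\Omega=0.\qquad(2)$$ The reduction of every motion in $Q$ whose velocity is such that $\Omega$ and $\dot\theta$ are differentiable is such a curve. **Second step.** $\mathbb T^3$ acts freely on $T\mathbb T^3\oplus(\mathbb T^3\times\mathfrak{so}(3))$ by $\varphi\cdot(\theta,\dot\theta,\Omega)=(\theta+\varphi,\dot\theta,\Omega)$, preserving the LP structure and $l_{1,O}$. $A_\theta(\dot\theta)=\dot\theta$ is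 a principal connection of $\mathbb T^3\to\{\bullet\}$ and induces a bijection $[\theta,\dot\theta,\Omega]\mapsto(\Omega_r,\Omega)=(\dot\theta,\Omega)$ from the quotient onto $\mathbb R^3\oplus\mathfrak{so}(3)$. The reduced structure over the point, whose bracket is $$[\xi_1\oplus v_1,\xi_2\oplus v_2]=[\xi_1,\xi_2]\oplus\big(\nabla^{V}_{\xi_1}v_2-\nabla^{V}_{\xi_2}v_1-\omega(\xi_1,\xi_2)+[v_1,v_2]\big)$$ with $\nabla^V$ the vertical quotient connection, is an LP bundle with $\nabla=0$, $\omega=0$ and $$[(\Omega_{r,1},\Omega_1),(\Omega_{r,2},\Omega_2)]=0\oplus(\Omega_1\times\Omega_2).$$ The reduced Lagrangian is $l_{2,O}(\Omega_r,\Omega)=\tfrac12\langle\Omega,(I+K)\Omega\rangle+\tfrac12\langle\Omega_r,K\Omega_r\rangle+\langle\Omega,K\Omega_r\rangle$. The horizontal LP equation is void, and the vertical one is equivalent to the pair $$(I+K)\dot\Omega+K\dot\Omega_r=((I+K)\Omega+K\Omega_r)\times\Omega,\qquad(3)$$ $$K\dot\Omega_r+K\dot\Omega=0,\qquad(4)$$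 which are its components along $\mathfrak{so}(3)$ and along $\mathbb R^3$. **Equivalence.** Let $\ell(\Omega,\Omega_r)=\tfrac12\langle\Omega,I\Omega\rangle+\tfrac12\langle\Omega+\Omega_r,K(\Omega+\Omega_r)\rangle$, the Lagrangian that $L$ induces on $\mathfrak{so}(3)\oplus\mathbb R^3$, with bracket $[(\alpha_1,\beta_1),(\alpha_2,\beta_2)]=(\alpha_1\times\alpha_2,0)$. The components of its Euler–Poincaré equation along $\mathfrak{so}(3)$ and $\mathbb R^3$ are equivalent to (3) and (4). Along every curve as in the first step, with $\Omega_r=\dot\theta$: the vertical and horizontal LP equations of the first step are equivalent, respectively, to the $\mathfrak{so}(3)$- and $\mathbb R^3$-components of the Euler–Poincaré equation, and also, respectively, to the $\mathfrak{so}(3)$- and $\mathbb R^3$-components of the vertical LP equation of the second step. In particular the three systems are equivalent, and the horizontal equation of the first step reappears as a vertical equation of the second step. -/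

import Mathlib

open Matrix Topology
open scoped ContDiff

noncomputable section

namespace RotorBody

/-! ### The groups `SO(3)` and `𝕋ⁿ = S¹ × ⋯ × S¹` -/

/-- `ℝ³`, with the scalar product `⬝ᵥ` and the cross product `⨯₃`. -/
abbrev V3 : Type := Fin 3 → ℝ

/-- Real `3 × 3` matrices. -/
abbrev Mat3 : Type := Matrix (Fin 3) (Fin 3) ℝ

/-- The rotation group `SO(3)`. -/
abbrev SO3 : Type := Matrix.specialOrthogonalGroup (Fin 3) ℝ

/-- The usual identification of `ℝ³` with the skew-symmetric matrices `𝔰𝔬(3)`: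
`hat a` is the matrix of `b ↦ a × b`. -/
def hat (a : V3) : Mat3 := !![0, -a 2, a 1; a 2, 0, -a 0; -a 1, a 0, 0]

/-- The inverse of `hat` on skew-symmetric matrices. -/
def vee (M : Mat3) : V3 := ![M 2 1, M 0 2, M 1 0]

theorem hat_mulVec (a b : V3) : hat a *ᵥ b = a ⨯₃ b := by
  ext i
  fin_cases i <;> simp [hat, cross_apply, Matrix.mulVec, dotProduct, Fin.sum_univ_three] <;> ring

theorem vee_hat (a : V3) : vee (hat a) = a := by
  ext i
  fin_cases i <;> simp [hat, vee]

theorem hat_skew (a : V3) : (hat a)ᵀ = -hat a := by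
  ext i j
  fin_cases i <;> fin_cases j <;> simp [hat]

theorem hat_vee {M : Mat3} (h : Mᵀ = -M) : hat (vee M) = M := by
  have e : ∀ i j, M j i = -M i j := fun i j => congrFun (congrFun h i) j
  have h00 := e 0 0
  have h11 := e 1 1
  have h22 := e 2 2
  ext i j
  fin_cases i <;> fin_cases j <;> simp [hat, vee] <;>
    first
      | linarith
      | linarith [e 0 1, e 0 2, e 1 2]

/-- The bracket of `𝔰𝔬(3)` is the cross product. -/
theorem hat_cross (a b : V3) : hat (a ⨯₃ b) = hat a * hat b - hat b * hat a := by
  ext i j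
  fin_cases i <;> fin_cases j <;>
    simp [hat, cross_apply] <;> ring

theorem coe_inv (g : SO3) : ((g⁻¹ : SO3) : Mat3) = (g : Mat3)ᵀ := by
  ext i j
  rfl

theorem conj_skew (g : SO3) (a : V3) :
    ((g : Mat3) * hat a * ((g⁻¹ : SO3) : Mat3))ᵀ
      = -((g : Mat3) * hat a * ((g⁻¹ : SO3) : Mat3)) := by
  rw [coe_inv]
  simp [Matrix.transpose_mul, hat_skew, Matrix.mul_assoc]

/-- The adjoint action of `SO(3)` on `𝔰𝔬(3) ≅ ℝ³`. -/
def Ad (g : SO3) (a : V3) : V3 := vee ((g : Mat3) * hat a * ((g⁻¹ : SO3) : Mat3))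

theorem hat_Ad (g : SO3) (a : V3) :
    hat (Ad g a) = (g : Mat3) * hat a * ((g⁻¹ : SO3) : Mat3) :=
  hat_vee (conj_skew g a)

theorem Ad_mul (g h : SO3) (a : V3) : Ad (g * h) a = Ad g (Ad h a) := by
  have e : hat (Ad (g * h) a) = hat (Ad g (Ad h a)) := by
    rw [hat_Ad, hat_Ad, hat_Ad, _root_.mul_inv_rev]
    simp only [Submonoid.coe_mul, Matrix.mul_assoc]
  simpa only [vee_hat] using congrArg vee e

theorem Ad_one (a : V3) : Ad 1 a = a := by
  simp [Ad, vee_hat]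

/-- The torus `S¹ × ⋯ × S¹` (`n` factors), written additively; `Torus 0` is a point. Its tangent
bundle is trivialised by translations, `T𝕋ⁿ = 𝕋ⁿ × ℝⁿ`. -/
abbrev Torus (n : ℕ) : Type := Fin n → Real.Angle

/-- The covering map `ℝⁿ → 𝕋ⁿ`. -/
def toTorus {n : ℕ} (x : Fin n → ℝ) : Torus n := fun i => (x i : Real.Angle)

/-- The curve `θ` in `𝕋ⁿ` has velocity `v` at time `t`. -/
def HasTorusVelocityAt {n : ℕ} (θ : ℝ → Torus n) (v : Fin n → ℝ) (t : ℝ) : Prop :=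
  ∃ x : ℝ → Fin n → ℝ, HasDerivAt x v t ∧ ∀ᶠ s in 𝓝 t, θ s = toTorus (x s)

/-- Smooth functions on `𝕋ⁿ`. -/
def SmoothOnTorus {n : ℕ} {W : Type} [NormedAddCommGroup W] [NormedSpace ℝ W]
    (f : Torus n → W) : Prop :=
  ContDiff ℝ ∞ fun x : Fin n → ℝ => f (toTorus x)

/-- The derivative of `f` at `θ` in the direction `v`. -/
def torusDeriv {n : ℕ} {W : Type} [NormedAddCommGroup W] [NormedSpace ℝ W]
    (f : Torus n → W) (θ : Torus n) (v : Fin n → ℝ) : W :=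
  fderiv ℝ (fun x : Fin n → ℝ => f (θ + toTorus x)) 0 v

/-! ### Lagrange–Poincaré bundles `T𝕋ⁿ ⊕ (𝕋ⁿ × F)` -/

/-- A point `q̇ ⊕ v` of `T𝕋ⁿ ⊕ (𝕋ⁿ × F)`. -/
@[ext]
structure LPPoint (n : ℕ) (F : Type) where
  q : Torus n
  dq : Fin n → ℝ
  v : F

/-- The additional structure of a Lagrange–Poincaré bundle on `T𝕋ⁿ ⊕ (𝕋ⁿ × F)`: a bracket in the
fibres of `V = 𝕋ⁿ × F`, a `V`-valued form of degree two, and a linear connection on `V`,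
`∇_X w = dw(X) + conn(X) w`. The laws are in `LPData.IsLPBundle`. -/
@[ext]
structure LPData (n : ℕ) (F : Type) where
  bracket : Torus n → F → F → F
  form : Torus n → (Fin n → ℝ) → (Fin n → ℝ) → F
  conn : Torus n → (Fin n → ℝ) → F → F

namespace LPData

variable {n : ℕ} {F : Type} [NormedAddCommGroup F] [NormedSpace ℝ F]

/-- The covariant derivative `∇_X w`. -/
def cov (P : LPData n F) (X : Torus n → Fin n → ℝ) (w : Torus n → F) (θ : Torus n) : F :=
  torusDeriv w θ (X θ) + P.conn θ (X θ) (w θ)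

/-- The bracket of sections `X ⊕ w` of `T𝕋ⁿ ⊕ V`:
`[X₁, X₂] ⊕ (∇_{X₁} w₂ - ∇_{X₂} w₁ - ω(X₁, X₂) + [w₁, w₂])`. -/
def sectionBracket (P : LPData n F) (s₁ s₂ : Torus n → (Fin n → ℝ) × F) :
    Torus n → (Fin n → ℝ) × F := fun θ =>
  (torusDeriv (fun η => (s₂ η).1) θ (s₁ θ).1 - torusDeriv (fun η => (s₁ η).1) θ (s₂ θ).1,
    P.cov (fun η => (s₁ η).1) (fun η => (s₂ η).2) θ
      - P.cov (fun η => (s₂ η).1) (fun η => (s₁ η).2) θ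
      - P.form θ (s₁ θ).1 (s₂ θ).1 + P.bracket θ (s₁ θ).2 (s₂ θ).2)

/-- The Lagrange–Poincaré bundle laws. -/
structure IsLPBundle (P : LPData n F) : Prop where
  bracket_bilinear : ∀ θ, ∃ b : F →ₗ[ℝ] F →ₗ[ℝ] F, ∀ u v, P.bracket θ u v = b u v
  bracket_self : ∀ θ u, P.bracket θ u u = 0
  bracket_jacobi : ∀ θ u v w, P.bracket θ u (P.bracket θ v w)
    + P.bracket θ v (P.bracket θ w u) + P.bracket θ w (P.bracket θ u v) = 0
  form_bilinear : ∀ θ, ∃ b : (Fin n → ℝ) →ₗ[ℝ] (Fin n → ℝ) →ₗ[ℝ] F,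
    ∀ X Y, P.form θ X Y = b X Y
  form_self : ∀ θ X, P.form θ X X = 0
  conn_bilinear : ∀ θ, ∃ b : (Fin n → ℝ) →ₗ[ℝ] F →ₗ[ℝ] F, ∀ X v, P.conn θ X v = b X v
  bracket_smooth : ∀ u v, SmoothOnTorus fun θ => P.bracket θ u v
  form_smooth : ∀ X Y, SmoothOnTorus fun θ => P.form θ X Y
  conn_smooth : ∀ X v, SmoothOnTorus fun θ => P.conn θ X v
  section_jacobi : ∀ s₁ s₂ s₃ : Torus n → (Fin n → ℝ) × F,
    SmoothOnTorus s₁ → SmoothOnTorus s₂ → SmoothOnTorus s₃ →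
      P.sectionBracket s₁ (P.sectionBracket s₂ s₃)
        + P.sectionBracket s₂ (P.sectionBracket s₃ s₁)
        + P.sectionBracket s₃ (P.sectionBracket s₁ s₂) = 0

end LPData

section Equations

variable {n : ℕ} {F : Type} [NormedAddCommGroup F] [NormedSpace ℝ F]

/-- `⟨∂L/∂v, w⟩` at `q̇ ⊕ v`. -/
def dFibre (L : LPPoint n F → ℝ) (c : LPPoint n F) (w : F) : ℝ :=
  fderiv ℝ (fun u : F => L ⟨c.q, c.dq, u⟩) c.v w

/-- `⟨∂L/∂q̇, δ⟩` at `q̇ ⊕ v`. -/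
def dVel (L : LPPoint n F → ℝ) (c : LPPoint n F) (δ : Fin n → ℝ) : ℝ :=
  fderiv ℝ (fun u : Fin n → ℝ => L ⟨c.q, u, c.v⟩) c.dq δ

/-- `⟨∂L/∂q, δ⟩` at `q̇ ⊕ v`: the derivative of `L` along the horizontal lift of `δ`, on which `q̇`
is translated and `v` is parallel, `v' = -conn(δ) v`. -/
def LPData.dBase (P : LPData n F) (L : LPPoint n F → ℝ) (c : LPPoint n F) (δ : Fin n → ℝ) : ℝ :=
  torusDeriv (fun q => L ⟨q, c.dq, c.v⟩) c.q δ - dFibre L c (P.conn c.q δ c.v)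

/-- The vertical Lagrange–Poincaré equation `D/dt ∂L/∂v = ad*_v ∂L/∂v` along the curve `c` at
time `t`, tested on `w`. Here `⟨ad*_v p, w⟩ = ⟨p, [v, w]⟩` and
`⟨Dp/dt, w⟩ = d/dt ⟨p, w⟩ - ⟨p, conn(q̇) w⟩` for constant `w`. -/
def LPData.VerticalEq (P : LPData n F) (L : LPPoint n F → ℝ) (c : ℝ → LPPoint n F) (t : ℝ)
    (w : F) : Prop :=
  HasDerivAt (fun s => dFibre L (c s) w)
    (dFibre L (c t) (P.bracket (c t).q (c t).v w)
      + dFibre L (c t) (P.conn (c t).q (c t).dq w)) t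

/-- The horizontal Lagrange–Poincaré equation `∂L/∂q - D/dt ∂L/∂q̇ = ⟨∂L/∂v, ω(q̇, ·)⟩` along
the curve `c` at time `t`, tested on `δ`. -/
def LPData.HorizontalEq (P : LPData n F) (L : LPPoint n F → ℝ) (c : ℝ → LPPoint n F) (t : ℝ)
    (δ : Fin n → ℝ) : Prop :=
  HasDerivAt (fun s => dVel L (c s) δ)
    (P.dBase L (c t) δ - dFibre L (c t) (P.form (c t).q (c t).dq δ)) t

/-- A curve `q̇(t) ⊕ v(t)` in `T𝕋ⁿ ⊕ (𝕋ⁿ × F)`, where `q̇` really is the velocity of `q`, regular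
enough for the Lagrange–Poincaré equations to be written at all times in `J`. -/
def IsAdmissibleOn (J : Set ℝ) (c : ℝ → LPPoint n F) : Prop :=
  ∀ t ∈ J, HasTorusVelocityAt (fun s => (c s).q) (c t).dq t ∧
    DifferentiableAt ℝ (fun s => (c s).dq) t ∧ DifferentiableAt ℝ (fun s => (c s).v) t

/-- The Euler–Poincaré equation `d/dt ∂ℓ/∂x = ad*_x ∂ℓ/∂x` in a Lie algebra `F` with bracket `br`,
tested on `w`. -/
def EulerPoincareEq (br : F → F → F) (l : F → ℝ) (x : ℝ → F) (t : ℝ) (w : F) : Prop :=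
  HasDerivAt (fun s => fderiv ℝ l (x s) w) (fderiv ℝ l (x t) (br (x t) w)) t

end Equations

/-! ### The configuration space and its tangent bundle -/

/-- The configuration space `SO(3) × S¹ × S¹ × S¹`. -/
@[ext]
structure Config where
  R : SO3
  θ : Torus 3

/-- `SO(3)` acts by left translations on the first factor. -/
instance : MulAction SO3 Config where
  smul g q := ⟨g * q.R, q.θ⟩
  one_smul q := Config.ext (one_mul q.R) rfl
  mul_smul g h q := Config.ext (mul_assoc g h q.R) rfl

/-- The tangent space at `(R, θ)`: pairs `(Ṙ, θ̇)` with `R⁻¹ Ṙ ∈ 𝔰𝔬(3)`. -/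
def tangentAt (q : Config) : Submodule ℝ (Mat3 × V3) where
  carrier := {v | (((q.R⁻¹ : SO3) : Mat3) * v.1)ᵀ = -(((q.R⁻¹ : SO3) : Mat3) * v.1)}
  add_mem' := by
    intro a b ha hb
    simp only [Set.mem_ofPred_eq] at ha hb ⊢
    rw [Prod.fst_add, Matrix.mul_add, Matrix.transpose_add, ha, hb, neg_add]
  zero_mem' := by simp
  smul_mem' := by
    intro r a ha
    simp only [Set.mem_ofPred_eq] at ha ⊢
    rw [Prod.smul_fst, Matrix.mul_smul, Matrix.transpose_smul, ha, smul_neg]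

theorem mem_tangentAt {q : Config} {v : Mat3 × V3} : v ∈ tangentAt q ↔
    (((q.R⁻¹ : SO3) : Mat3) * v.1)ᵀ = -(((q.R⁻¹ : SO3) : Mat3) * v.1) := Iff.rfl

/-- The tangent bundle of the configuration space. -/
structure TConfig where
  base : Config
  vec : tangentAt base

theorem TConfig.ext' {v w : TConfig} (h : v.base = w.base)
    (h' : (v.vec : Mat3 × V3) = (w.vec : Mat3 × V3)) : v = w := by
  obtain ⟨q, x⟩ := v
  obtain ⟨q', y⟩ := w
  obtain rfl : q = q' := h
  obtain rfl : x = y := Subtype.ext h'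
  rfl

/-- The tangent lift `(Ṙ, θ̇) ↦ (g Ṙ, θ̇)` of the action of `SO(3)`. -/
def liftVec (g : SO3) {q : Config} (v : tangentAt q) : tangentAt (g • q) :=
  ⟨((g : Mat3) * v.1.1, v.1.2), by
    have e : ((((g • q).R)⁻¹ : SO3) : Mat3) * ((g : Mat3) * v.1.1)
        = ((q.R⁻¹ : SO3) : Mat3) * v.1.1 := by
      change (((g * q.R)⁻¹ : SO3) : Mat3) * ((g : Mat3) * v.1.1) = _
      rw [← Matrix.mul_assoc, ← Submonoid.coe_mul, _root_.mul_inv_rev, inv_mul_cancel_right]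
    rw [mem_tangentAt]
    simp only [e]
    exact v.2⟩

instance : MulAction SO3 TConfig where
  smul g v := ⟨g • v.base, liftVec g v.vec⟩
  one_smul v := TConfig.ext' (one_smul SO3 v.base)
    (Prod.ext (one_mul (v.vec : Mat3 × V3).1) rfl)
  mul_smul g h v := TConfig.ext' (mul_smul g h v.base)
    (Prod.ext (mul_assoc (g : Mat3) (h : Mat3) (v.vec : Mat3 × V3).1) rfl)

/-- The body angular velocity `Ω = R⁻¹ Ṙ`. -/
def bodyVel (v : TConfig) : V3 := vee (((v.base.R⁻¹ : SO3) : Mat3) * (v.vec : Mat3 × V3).1)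

/-- The rotor angular velocity `θ̇`. -/
def rotorVel (v : TConfig) : V3 := (v.vec : Mat3 × V3).2

/-- The Lagrangian of the free rigid body with rotors. -/
def lagrangian (I K : Mat3) (v : TConfig) : ℝ :=
  1 / 2 * (bodyVel v ⬝ᵥ (I *ᵥ bodyVel v))
    + 1 / 2 * ((bodyVel v + rotorVel v) ⬝ᵥ (K *ᵥ (bodyVel v + rotorVel v)))

/-- `v` is the velocity of the curve `q` in the configuration space at time `t`. -/
def HasConfigVelocityAt (q : ℝ → Config) (v : Mat3 × V3) (t : ℝ) : Prop :=
  (∀ i j, HasDerivAt (fun s => ((q s).R : Mat3) i j) (v.1 i j) t) ∧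
    HasTorusVelocityAt (fun s => (q s).θ) v.2 t

/-! ### Principal connections on `SO(3) × 𝕋³ → 𝕋³` -/

/-- `𝔰𝔬(3)`-valued one-forms on the configuration space. -/
abbrev OneForm : Type := (q : Config) → tangentAt q →ₗ[ℝ] V3

/-- The ambient space of `SO(3) × ℝ³`, the matrix space (as a space of arrays) times `ℝ³`. -/
abbrev Ambient : Type := (Fin 3 → Fin 3 → ℝ) × V3

/-- A pair of a matrix and a vector as an element of the ambient space. -/
def toAmbient (v : Mat3 × V3) : Ambient := (fun i j => v.1 i j, v.2)

/-- A smooth one-form on the matrix space times the cover `ℝ³` of `𝕋³` that restricts to `A` on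
`SO(3) × 𝕋³`. -/
def IsSmoothExtension (A : OneForm) (B : Ambient → (Ambient →L[ℝ] V3)) : Prop :=
  ContDiff ℝ ∞ B ∧ ∀ (R : SO3) (x : V3) (v : tangentAt ⟨R, toTorus x⟩),
    B (toAmbient ((R : Mat3), x)) (toAmbient v) = A ⟨R, toTorus x⟩ v

/-- Smooth one-forms: restrictions of smooth one-forms of the ambient space. -/
def OneForm.Smooth (A : OneForm) : Prop := ∃ B, IsSmoothExtension A B

open Classical in
/-- The exterior derivative `dA(v, w)` of a smooth one-form on the configuration space: the
restriction of the exterior derivative of a smooth extension (of any one, by naturality). -/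
def OneForm.extDeriv (A : OneForm) (q : Config) (v w : tangentAt q) : V3 :=
  if h : ∃ B, IsSmoothExtension A B then
    fderiv ℝ h.choose (toAmbient ((q.R : Mat3), fun i => (q.θ i).toReal))
        (toAmbient v) (toAmbient w)
      - fderiv ℝ h.choose (toAmbient ((q.R : Mat3), fun i => (q.θ i).toReal))
        (toAmbient w) (toAmbient v)
  else 0

/-- The infinitesimal generator of `ξ ∈ 𝔰𝔬(3)`: `d/dt exp(tξ) R = ξ R`. -/
def generator (ξ : V3) (q : Config) : tangentAt q :=
  ⟨(hat ξ * (q.R : Mat3), 0), by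
    rw [mem_tangentAt]
    have e := conj_skew q.R⁻¹ ξ
    rw [inv_inv, Matrix.mul_assoc] at e
    exact e⟩

/-- Principal connections of the principal `SO(3)`-bundle `SO(3) × 𝕋³ → 𝕋³`. -/
structure IsPrincipalConnection (A : OneForm) : Prop where
  smooth : A.Smooth
  vertical : ∀ ξ q, A q (generator ξ q) = ξ
  equivariant : ∀ (g : SO3) (q : Config) (v : tangentAt q),
    A (g • q) (liftVec g v) = Ad g (A q v)

/-- The horizontal projection of a connection. -/
def hor (A : OneForm) (q : Config) (v : tangentAt q) : tangentAt q := v - generator (A q v) q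

/-- The curvature `B(v, w) = dA(Hor v, Hor w)`. -/
def curvature (A : OneForm) (q : Config) (v w : tangentAt q) : V3 :=
  A.extDeriv q (hor A q v) (hor A q w)

/-- The horizontal lift of `X ∈ T_θ 𝕋³` at `q = (R, θ)`. -/
def horLift (A : OneForm) (q : Config) (X : V3) : tangentAt q :=
  hor A q ⟨(0, X), by rw [mem_tangentAt]; simp⟩

/-- The Maurer–Cartan connection `A(Ṙ, θ̇) = Ṙ R⁻¹`. -/
def maurerCartan : OneForm := fun q =>
  { toFun := fun v => vee ((v : Mat3 × V3).1 * ((q.R⁻¹ : SO3) : Mat3))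
    map_add' := by
      intro v w
      ext i
      fin_cases i <;> simp [vee, Matrix.add_mul]
    map_smul' := by
      intro r v
      ext i
      fin_cases i <;> simp [vee] }

/-! ### The adjoint bundle -/

/-- The product `(SO(3) × 𝕋³) × 𝔰𝔬(3)`. -/
@[ext]
structure ConfigLie where
  q : Config
  ξ : V3

instance : MulAction SO3 ConfigLie where
  smul g p := ⟨g • p.q, Ad g p.ξ⟩
  one_smul p := ConfigLie.ext (one_smul SO3 p.q) (Ad_one p.ξ)
  mul_smul g h p := ConfigLie.ext (mul_smul g h p.q) (Ad_mul g h p.ξ)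

/-- The adjoint bundle `((SO(3) × 𝕋³) × 𝔰𝔬(3)) / SO(3)` over `𝕋³`. -/
abbrev AdjointBundle : Type := MulAction.orbitRel.Quotient SO3 ConfigLie

/-- The class `[q, ξ]`. -/
def adjMk (q : Config) (ξ : V3) : AdjointBundle :=
  Quotient.mk (MulAction.orbitRel SO3 ConfigLie) ⟨q, ξ⟩

/-- The trivialisation `[(R, θ), ξ] ↦ (θ, Ad_{R⁻¹} ξ)` of the adjoint bundle. -/
def adjTriv (e : AdjointBundle) : Torus 3 × V3 :=
  Quotient.lift (s := MulAction.orbitRel SO3 ConfigLie)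
    (fun p : ConfigLie => (p.q.θ, Ad p.q.R⁻¹ p.ξ))
    (by
      rintro a b ⟨g, rfl⟩
      change ((b.q.θ, Ad (g * b.q.R)⁻¹ (Ad g b.ξ)) : Torus 3 × V3) = _
      rw [← Ad_mul, _root_.mul_inv_rev, inv_mul_cancel_right]) e

/-- The Whitney sum `T𝕋³ ⊕ 𝔰𝔬(3)~` of the tangent bundle and the adjoint bundle. -/
def ReducedBundle : Type := {p : (Torus 3 × V3) × AdjointBundle // (adjTriv p.2).1 = p.1.1}

/-- The map `(R, θ, Ṙ, θ̇) ↦ (θ, θ̇, [(R, θ), A(Ṙ, θ̇)])` that identifies the quotient of the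
tangent bundle by `SO(3)` with `T𝕋³ ⊕ 𝔰𝔬(3)~`. -/
def connectionMap (A : OneForm) (v : TConfig) : ReducedBundle :=
  ⟨((v.base.θ, rotorVel v), adjMk v.base (A v.base v.vec)), rfl⟩

/-- The trivialisation of `T𝕋³ ⊕ 𝔰𝔬(3)~`. -/
def trivialise (p : ReducedBundle) : LPPoint 3 V3 := ⟨p.1.1.1, p.1.1.2, (adjTriv p.1.2).2⟩

/-- In the trivialisation, the bracket `[[q, ξ], [q, η]] = [q, [ξ, η]]`, the form
`B̃(X, Y) = [q, B(Hor X, Hor Y)]` and the covariant derivative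
`D/dt [q, ξ] = [q, ξ' - [A(q'), ξ]]` of the adjoint bundle with the connection `A` are those
of `P`. -/
structure IsAdjointStructure (A : OneForm) (P : LPData 3 V3) : Prop where
  bracket : ∀ (q : Config) (ξ η : V3), (adjTriv (adjMk q (ξ ⨯₃ η))).2
    = P.bracket q.θ (adjTriv (adjMk q ξ)).2 (adjTriv (adjMk q η)).2
  form : ∀ (q : Config) (X Y : V3),
    (adjTriv (adjMk q (curvature A q (horLift A q X) (horLift A q Y)))).2 = P.form q.θ X Y
  conn : ∀ (q : ℝ → Config) (ξ : ℝ → V3) (t : ℝ) (v : tangentAt (q t)) (ξ' : V3),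
    HasConfigVelocityAt q v t → HasDerivAt ξ ξ' t →
      ∃ a' : V3, HasDerivAt (fun s => (adjTriv (adjMk (q s) (ξ s))).2) a' t ∧
        (adjTriv (adjMk (q t) (ξ' - A (q t) v ⨯₃ ξ t))).2
          = a' + P.conn (q t).θ (v : Mat3 × V3).2 (adjTriv (adjMk (q t) (ξ t))).2

/-- The Lagrange–Poincaré bundle `T𝕋³ ⊕ (𝕋³ × 𝔰𝔬(3))` with the cross product in the fibres, the
zero form and the trivial covariant derivative. -/
def firstLP : LPData 3 V3 where
  bracket _ a b := a ⨯₃ b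
  form _ _ _ := 0
  conn _ _ _ := 0

/-- The first reduced Lagrangian. -/
def l₁ (I K : Mat3) (c : LPPoint 3 V3) : ℝ :=
  1 / 2 * (c.v ⬝ᵥ ((I + K) *ᵥ c.v)) + 1 / 2 * (c.dq ⬝ᵥ (K *ᵥ c.dq)) + c.v ⬝ᵥ (K *ᵥ c.dq)

/-! ### Reduction by the torus -/

/-- The torus acts by `φ · (θ, θ̇, v) = (θ + φ, θ̇, v)`. -/
instance {n : ℕ} {F : Type} : AddAction (Torus n) (LPPoint n F) where
  vadd φ c := ⟨c.q + φ, c.dq, c.v⟩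
  zero_vadd c := LPPoint.ext (add_zero c.q) rfl rfl
  add_vadd φ ψ c := LPPoint.ext (by
    change c.q + (φ + ψ) = c.q + ψ + φ
    rw [add_comm φ ψ, add_assoc]) rfl rfl

/-- The torus acts by isomorphisms of Lagrange–Poincaré bundles. -/
def LPData.TorusInvariant {n : ℕ} {F : Type} (P : LPData n F) : Prop :=
  ∀ φ θ : Torus n, P.bracket (θ + φ) = P.bracket θ ∧ P.form (θ + φ) = P.form θ ∧
    P.conn (θ + φ) = P.conn θ

/-- Principal connections of `𝕋ⁿ → {•}`: the generator of `ξ ∈ ℝⁿ` is the constant field `ξ`, and the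
adjoint action is trivial. -/
structure IsTorusConnection {n : ℕ} (A : Torus n → (Fin n → ℝ) →ₗ[ℝ] (Fin n → ℝ)) : Prop where
  smooth : ∀ X, SmoothOnTorus fun θ => A θ X
  vertical : ∀ (ξ : Fin n → ℝ) (θ : Torus n), A θ ξ = ξ
  equivariant : ∀ (φ θ : Torus n), A (θ + φ) = A θ

/-- The connection `A_θ(θ̇) = θ̇`. -/
def torusConnection : Torus 3 → V3 →ₗ[ℝ] V3 := fun _ => LinearMap.id

/-- The map `(θ, θ̇, v) ↦ (A_θ(θ̇), v)` to the reduced bundle `ℝⁿ ⊕ F` over a point. -/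
def torusQuotientMap {n : ℕ} {F : Type} (A : Torus n → (Fin n → ℝ) →ₗ[ℝ] (Fin n → ℝ)) (c : LPPoint n F) :
    LPPoint 0 ((Fin n → ℝ) × F) := ⟨0, 0, (A c.q c.dq, c.v)⟩

/-- The vertical quotient connection: `∇_W v` for the vertical invariant field `W` with `A(W) = ξ`,
that is, the generator `W = ξ`, and the invariant section `v`. By invariance its value can be
taken at any point of `𝕋ⁿ`. -/
def LPData.vertCov {n : ℕ} {F : Type} [NormedAddCommGroup F] [NormedSpace ℝ F] (P : LPData n F)
    (ξ : Fin n → ℝ) (v : F) : F := P.cov (fun _ => ξ) (fun _ => v) 0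

/-- The reduction of a torus-invariant Lagrange–Poincaré bundle over `𝕋ⁿ` by the torus. The bracket
on `ℝⁿ ⊕ F` is
`[ξ₁, ξ₂] ⊕ (∇ᵛ_{ξ₁} v₂ - ∇ᵛ_{ξ₂} v₁ - ω(ξ₁, ξ₂) + [v₁, v₂])`, and `[ξ₁, ξ₂] = 0` in the abelian
Lie algebra `ℝⁿ`. The form `B̃ ⊕ ω` and the connection `∇ᴬ_X ξ ⊕ (∇_{Xʰ} v - ω(Xʰ, ξ))` are taken on
tangent vectors of the base, a point, whose horizontal lift `Xʰ` is `0`. -/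
def LPData.torusReduction {n : ℕ} {F : Type} [NormedAddCommGroup F] [NormedSpace ℝ F]
    (P : LPData n F) : LPData 0 ((Fin n → ℝ) × F) where
  bracket _ a b := (0, P.vertCov a.1 b.2 - P.vertCov b.1 a.2 - P.form 0 a.1 b.1
    + P.bracket 0 a.2 b.2)
  form _ _ _ := (0, P.form 0 0 0)
  conn _ _ a := (0, P.conn 0 0 a.2 - P.form 0 0 a.1)

/-- The second reduced Lagrangian, at `(Ω_r, Ω)`. -/
def l₂ (I K : Mat3) (c : LPPoint 0 (V3 × V3)) : ℝ :=
  1 / 2 * (c.v.2 ⬝ᵥ ((I + K) *ᵥ c.v.2)) + 1 / 2 * (c.v.1 ⬝ᵥ (K *ᵥ c.v.1))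
    + c.v.2 ⬝ᵥ (K *ᵥ c.v.1)

/-! ### Euler–Poincaré reduction by the whole group -/

/-- The bracket `[(α₁, β₁), (α₂, β₂)] = (α₁ × α₂, 0)` of `𝔰𝔬(3) ⊕ ℝ³`. -/
def fullBracket (a b : V3 × V3) : V3 × V3 := (a.1 ⨯₃ b.1, 0)

/-- The Euler–Poincaré reduced Lagrangian, at `(Ω, Ω_r)`. -/
def lEP (I K : Mat3) (x : V3 × V3) : ℝ :=
  1 / 2 * (x.1 ⬝ᵥ (I *ᵥ x.1)) + 1 / 2 * ((x.1 + x.2) ⬝ᵥ (K *ᵥ (x.1 + x.2)))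

end RotorBody

end

open RotorBody

/-!
Everything reduces to two momenta. With `Ω = R⁻¹ Ṙ` and `Ω_r = θ̇`, the Lagrangian is the quadratic
function `lEP` of `(Ω, Ω_r)`, and its derivative at `(Ω, Ω_r)` in the direction `(α, β)` is
`⟨α, p⟩ + ⟨β, π⟩` with the body momentum `p = (I + K)Ω + KΩ_r` and the rotor momentum
`π = KΩ_r + KΩ` (`fderiv_lEP`; here the symmetry of `I` and `K` enters). The functions `l₁` and `l₂`
are `lEP` with the variables renamed, so their fibre and velocity derivatives are the same momenta.
Since all forms and connections vanish and the only bracket is the cross product, each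
Lagrange–Poincaré or Euler–Poincaré equation, tested on a constant vector, is literally one of two
scalar equations: `BodyBalance`, `d/dt ⟨α, p⟩ = ⟨α, p × Ω⟩`, or `RotorBalance`, `d/dt ⟨β, π⟩ = 0`.
The first occurs as the vertical equation of the first step, the second as the horizontal one, and
both as components of the vertical equation of the second step and of the Euler–Poincaré equation.
Testing on all vectors gives the vector equations (`forall_hasDerivAt_dotProduct_iff`).

On the geometric side, `Ṙ = A(Ṙ, θ̇) R` for the Maurer–Cartan form `A`, so the horizontal vectors
are those along the torus; `A` vanishes on them identically, hence so does its exterior derivative,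
whichever extension computes it (`fderiv_extension_maurerCartan`). The trivialised covariant
derivative is trivial because `d/dt Ad_{R⁻¹} ξ = Ad_{R⁻¹} (ξ' - A × ξ)` (`hasDerivAt_Ad_inv`). The
Jacobi identity for sections of a bundle with constant Lie bracket is checked on the universal cover
`ℝⁿ` of the torus, by the symmetry of second derivatives (`coverBracket_jacobi`).
-/

namespace RotorBody

/-! ### Lagrange–Poincaré bundles with constant bracket -/

section ConstantBracket

variable {n : ℕ} {F : Type} [NormedAddCommGroup F] [NormedSpace ℝ F]

theorem toTorus_add (x y : Fin n → ℝ) : toTorus (x + y) = toTorus x + toTorus y := by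
  ext i
  simp [toTorus]

theorem toTorus_surjective : Function.Surjective (toTorus (n := n)) := fun θ =>
  ⟨fun i => (θ i).toReal, funext fun i => (θ i).coe_toReal⟩

theorem torusDeriv_toTorus {W : Type} [NormedAddCommGroup W] [NormedSpace ℝ W]
    (f : Torus n → W) (x v : Fin n → ℝ) :
    torusDeriv f (toTorus x) v = fderiv ℝ (f ∘ toTorus) x v := by
  have h := fderiv_comp_add_left (𝕜 := ℝ) (f := f ∘ toTorus) (x := 0) x
  rw [add_zero] at h
  rw [← h]
  simp only [torusDeriv, Function.comp_apply, toTorus_add]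

/-- The bracket of sections of the bundle with constant bracket `b`, zero form and trivial
connection, written on the universal cover `ℝⁿ` of the torus. -/
noncomputable def coverBracket (b : F →L[ℝ] F →L[ℝ] F) (f g : (Fin n → ℝ) → (Fin n → ℝ) × F)
    (x : Fin n → ℝ) : (Fin n → ℝ) × F :=
  fderiv ℝ g x (f x).1 - fderiv ℝ f x (g x).1 + (0, b (f x).2 (g x).2)

theorem sectionBracket_toTorus {P : LPData n F} {b : F →L[ℝ] F →L[ℝ] F}
    (hb : ∀ θ u v, P.bracket θ u v = b u v) (hf : P.form = 0) (hc : P.conn = 0)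
    {s₁ s₂ : Torus n → (Fin n → ℝ) × F} (h₁ : Differentiable ℝ (s₁ ∘ toTorus))
    (h₂ : Differentiable ℝ (s₂ ∘ toTorus)) (x : Fin n → ℝ) :
    P.sectionBracket s₁ s₂ (toTorus x) = coverBracket b (s₁ ∘ toTorus) (s₂ ∘ toTorus) x := by
  have e₁ : ∀ {s : Torus n → (Fin n → ℝ) × F}, Differentiable ℝ (s ∘ toTorus) → ∀ v,
      fderiv ℝ ((fun η => (s η).1) ∘ toTorus) x v = (fderiv ℝ (s ∘ toTorus) x v).1 :=
    fun h v => by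
      have := (h x).hasFDerivAt.fst.fderiv
      exact congrArg (fun L => L v) this
  have e₂ : ∀ {s : Torus n → (Fin n → ℝ) × F}, Differentiable ℝ (s ∘ toTorus) → ∀ v,
      fderiv ℝ ((fun η => (s η).2) ∘ toTorus) x v = (fderiv ℝ (s ∘ toTorus) x v).2 :=
    fun h v => by
      have := (h x).hasFDerivAt.snd.fderiv
      exact congrArg (fun L => L v) this
  ext1
  · simp [LPData.sectionBracket, coverBracket, torusDeriv_toTorus, e₁ h₁, e₁ h₂]
  · simp [LPData.sectionBracket, LPData.cov, coverBracket, torusDeriv_toTorus, e₂ h₁, e₂ h₂,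
      hb, hf, hc]

theorem fderiv_coverBracket (b : F →L[ℝ] F →L[ℝ] F) {f g : (Fin n → ℝ) → (Fin n → ℝ) × F}
    (hf : ContDiff ℝ ∞ f) (hg : ContDiff ℝ ∞ g) (x : Fin n → ℝ) :
    DifferentiableAt ℝ (coverBracket b f g) x ∧ ∀ u, fderiv ℝ (coverBracket b f g) x u
      = fderiv ℝ (fderiv ℝ g) x u (f x).1 + fderiv ℝ g x (fderiv ℝ f x u).1
        - (fderiv ℝ (fderiv ℝ f) x u (g x).1 + fderiv ℝ f x (fderiv ℝ g x u).1)
        + (0, b (f x).2 (fderiv ℝ g x u).2 + b (fderiv ℝ f x u).2 (g x).2) := by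
  have hf' := (hf.differentiable (by simp) x).hasFDerivAt
  have hg' := (hg.differentiable (by simp) x).hasFDerivAt
  have hf2 := ((hf.fderiv_right (m := ∞) (by simp)).differentiable (by simp) x).hasFDerivAt
  have hg2 := ((hg.fderiv_right (m := ∞) (by simp)).differentiable (by simp) x).hasFDerivAt
  have h := ((hg2.clm_apply hf'.fst).sub (hf2.clm_apply hg'.fst)).add
    ((hasFDerivAt_const (0 : Fin n → ℝ) x).prodMk (b.hasFDerivAt_of_bilinear hf'.snd hg'.snd))
  have h' : HasFDerivAt (coverBracket b f g) _ x := h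
  refine ⟨h'.differentiableAt, fun u => ?_⟩
  rw [h'.fderiv]
  ext1
  · simp
    abel
  · simp
    abel

/-- The Jacobi identity: the second derivatives cancel by symmetry, the rest by the Jacobi identity
of `b`. -/
theorem coverBracket_jacobi {b : F →L[ℝ] F →L[ℝ] F} (hs : ∀ u, b u u = 0)
    (hj : ∀ u v w, b u (b v w) + b v (b w u) + b w (b u v) = 0)
    {f g h : (Fin n → ℝ) → (Fin n → ℝ) × F}
    (hf : ContDiff ℝ ∞ f) (hg : ContDiff ℝ ∞ g) (hh : ContDiff ℝ ∞ h) (x : Fin n → ℝ) :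
    coverBracket b f (coverBracket b g h) x + coverBracket b g (coverBracket b h f) x
      + coverBracket b h (coverBracket b f g) x = 0 := by
  have sym : ∀ {k : (Fin n → ℝ) → (Fin n → ℝ) × F}, ContDiff ℝ ∞ k → ∀ u v,
      fderiv ℝ (fderiv ℝ k) x u v = fderiv ℝ (fderiv ℝ k) x v u := fun hk u v =>
    (hk.contDiffAt.isSymmSndFDerivAt (by
      rw [minSmoothness_of_isRCLikeNormedField]; exact WithTop.coe_le_coe.2 le_top)) u v
  have anti : ∀ u v, b u v = -b v u := fun u v => by
    have := hs (u + v)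
    simp only [map_add, _root_.add_apply, hs, zero_add, add_zero] at this
    exact eq_neg_of_add_eq_zero_right this
  have e : ∀ (p q : (Fin n → ℝ) → (Fin n → ℝ) × F), coverBracket b p q x
      = fderiv ℝ q x (p x).1 - fderiv ℝ p x (q x).1 + (0, b (p x).2 (q x).2) := fun _ _ => rfl
  rw [e f (coverBracket b g h), e g (coverBracket b h f), e h (coverBracket b f g),
    (fderiv_coverBracket b hg hh x).2, (fderiv_coverBracket b hh hf x).2,
    (fderiv_coverBracket b hf hg x).2, e g h, e h f, e f g,
    sym hf (h x).1 (g x).1, sym hg (f x).1 (h x).1, sym hh (g x).1 (f x).1]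
  have J := hj (f x).2 (g x).2 (h x).2
  simp only [Prod.fst_add, Prod.fst_sub, Prod.snd_add, Prod.snd_sub, add_zero, map_add, map_sub]
  ext1
  · simp only [Prod.fst_add, Prod.fst_sub, Prod.fst_zero]
    abel
  · simp only [Prod.snd_add, Prod.snd_sub, Prod.snd_zero]
    -- the terms `b (Df ·) ·` cancel the terms `b · (Df ·)` after exchanging the arguments
    rw [anti (fderiv ℝ g x (f x).1).2, anti (fderiv ℝ h x (g x).1).2,
      anti (fderiv ℝ f x (h x).1).2]
    rw [← J]
    abel

/-- A constant Lie bracket in the fibres, the zero form and the trivial connection make a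
Lagrange–Poincaré bundle. -/
theorem isLPBundle_of_constant [FiniteDimensional ℝ F] {P : LPData n F} (b : F →ₗ[ℝ] F →ₗ[ℝ] F)
    (hb : ∀ θ u v, P.bracket θ u v = b u v) (hf : P.form = 0) (hc : P.conn = 0)
    (hs : ∀ u, b u u = 0)
    (hj : ∀ u v w, b u (b v w) + b v (b w u) + b w (b u v) = 0) : P.IsLPBundle where
  bracket_bilinear θ := ⟨b, hb θ⟩
  bracket_self θ u := by rw [hb, hs]
  bracket_jacobi θ u v w := by simp only [hb, hj]
  form_bilinear θ := ⟨0, fun X Y => by rw [hf]; rfl⟩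
  form_self θ X := by rw [hf]; rfl
  conn_bilinear θ := ⟨0, fun X v => by rw [hc]; rfl⟩
  bracket_smooth u v := by simpa only [SmoothOnTorus, hb] using contDiff_const
  form_smooth X Y := by
    rw [hf]
    exact contDiff_const (c := (0 : F))
  conn_smooth X v := by
    rw [hc]
    exact contDiff_const (c := (0 : F))
  section_jacobi s₁ s₂ s₃ h₁ h₂ h₃ := by
    have key : ∀ {s t : Torus n → (Fin n → ℝ) × F}, SmoothOnTorus s → SmoothOnTorus t →
        P.sectionBracket s t ∘ toTorus
          = coverBracket b.toContinuousBilinearMap (s ∘ toTorus) (t ∘ toTorus) :=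
      fun hs ht => funext fun x => sectionBracket_toTorus (b := b.toContinuousBilinearMap)
        hb hf hc (ContDiff.differentiable hs (by simp)) (ContDiff.differentiable ht (by simp)) x
    have key₂ : ∀ {r s t : Torus n → (Fin n → ℝ) × F}, SmoothOnTorus r → SmoothOnTorus s →
        SmoothOnTorus t → ∀ x, P.sectionBracket r (P.sectionBracket s t) (toTorus x)
          = coverBracket b.toContinuousBilinearMap (r ∘ toTorus)
            (coverBracket b.toContinuousBilinearMap (s ∘ toTorus) (t ∘ toTorus)) x :=
      fun hr hs ht x => by
        rw [← key hs ht]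
        refine sectionBracket_toTorus (b := b.toContinuousBilinearMap)
          hb hf hc (ContDiff.differentiable hr (by simp)) ?_ x
        rw [key hs ht]
        exact fun y => (fderiv_coverBracket _ hs ht y).1
    funext θ
    obtain ⟨x, rfl⟩ := toTorus_surjective θ
    simp only [Pi.add_apply, key₂ h₁ h₂ h₃, key₂ h₂ h₃ h₁, key₂ h₃ h₁ h₂]
    exact coverBracket_jacobi (b := b.toContinuousBilinearMap) hs hj h₁ h₂ h₃ x

end ConstantBracket

theorem firstLP_isLPBundle : firstLP.IsLPBundle :=
  isLPBundle_of_constant (crossProduct (R := ℝ)) (fun _ _ _ => rfl) rfl rfl cross_self jacobi_cross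

theorem torusReduction_firstLP : firstLP.torusReduction
    = { bracket := fun _ a b => (0, a.2 ⨯₃ b.2), form := 0, conn := 0 } := by
  have h : ∀ ξ v, firstLP.vertCov ξ v = 0 := fun ξ v => by
    simp [LPData.vertCov, LPData.cov, torusDeriv, firstLP]
  ext1
  · funext θ a b
    simp only [LPData.torusReduction, h]
    simp [firstLP]
  · funext θ X Y
    simp [LPData.torusReduction, firstLP]
  · funext θ X a
    simp [LPData.torusReduction, firstLP]

theorem torusReduction_firstLP_isLPBundle : firstLP.torusReduction.IsLPBundle := by
  rw [torusReduction_firstLP]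
  refine isLPBundle_of_constant (LinearMap.mk₂ ℝ (fun a b : V3 × V3 => ((0, a.2 ⨯₃ b.2) : V3 × V3))
    (fun a a' b => ?_) (fun r a b => ?_) (fun a b b' => ?_) (fun r a b => ?_))
    (fun _ _ _ => rfl) rfl rfl (fun u => ?_) (fun u v w => ?_)
  · simp
  · simp
  · simp
  · simp
  · simp [cross_self]
  · simpa using jacobi_cross u.2 v.2 w.2

/-! ### The Lagrange–Poincaré and Euler–Poincaré equations -/

/-- The momentum `(I + K)Ω + KΩ_r` conjugate to the body angular velocity. -/
def bodyMomentum (I K : Mat3) (x : V3 × V3) : V3 := (I + K) *ᵥ x.1 + K *ᵥ x.2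

/-- The momentum `KΩ_r + KΩ` conjugate to the rotor angular velocity. -/
def rotorMomentum (K : Mat3) (x : V3 × V3) : V3 := K *ᵥ x.2 + K *ᵥ x.1

theorem dotProduct_mulVec_comm {A : Mat3} (hA : A.IsSymm) (x y : V3) :
    x ⬝ᵥ A *ᵥ y = y ⬝ᵥ A *ᵥ x := by
  rw [Matrix.dotProduct_mulVec, ← Matrix.mulVec_transpose, hA.eq, dotProduct_comm]

theorem differentiable_lEP (I K : Mat3) : Differentiable ℝ (lEP I K) := by
  unfold lEP Matrix.mulVec dotProduct
  simp only [Pi.add_apply]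
  fun_prop

theorem lEP_add_smul {I K : Mat3} (hI : I.IsSymm) (hK : K.IsSymm) (x w : V3 × V3) (s : ℝ) :
    lEP I K (x + s • w) = lEP I K x
      + s * (w.1 ⬝ᵥ bodyMomentum I K x + w.2 ⬝ᵥ rotorMomentum K x) + s ^ 2 * lEP I K w := by
  simp only [lEP, bodyMomentum, rotorMomentum, Prod.fst_add, Prod.snd_add, Prod.smul_fst,
    Prod.smul_snd, Matrix.mulVec_add, Matrix.add_mulVec, Matrix.mulVec_smul, dotProduct_add,
    add_dotProduct, smul_dotProduct, dotProduct_smul, smul_eq_mul]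
  rw [dotProduct_mulVec_comm hI x.1 w.1, dotProduct_mulVec_comm hK x.1 w.1,
    dotProduct_mulVec_comm hK x.2 w.1, dotProduct_mulVec_comm hK x.1 w.2,
    dotProduct_mulVec_comm hK x.2 w.2]
  ring

theorem fderiv_lEP {I K : Mat3} (hI : I.IsSymm) (hK : K.IsSymm) (x w : V3 × V3) :
    fderiv ℝ (lEP I K) x w = w.1 ⬝ᵥ bodyMomentum I K x + w.2 ⬝ᵥ rotorMomentum K x := by
  have h₁ : HasDerivAt (fun s : ℝ => lEP I K (x + s • w)) (fderiv ℝ (lEP I K) x w) 0 := by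
    have hl : HasDerivAt (fun s : ℝ => x + s • w) w 0 := by
      simpa using ((hasDerivAt_id (0 : ℝ)).smul_const w).const_add x
    have hf : HasFDerivAt (lEP I K) (fderiv ℝ (lEP I K) x) (x + (0 : ℝ) • w) := by
      simpa using (differentiable_lEP I K x).hasFDerivAt
    exact hf.comp_hasDerivAt 0 hl
  have h₂ : HasDerivAt (fun s : ℝ => lEP I K (x + s • w))
      (w.1 ⬝ᵥ bodyMomentum I K x + w.2 ⬝ᵥ rotorMomentum K x) 0 := by
    simp only [lEP_add_smul hI hK]
    simpa using (((hasDerivAt_id' (0 : ℝ)).mul_const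
      (w.1 ⬝ᵥ bodyMomentum I K x + w.2 ⬝ᵥ rotorMomentum K x)).const_add (lEP I K x)).fun_add
      (((hasDerivAt_id' (0 : ℝ)).fun_pow 2).mul_const (lEP I K w))
  exact h₁.unique h₂

theorem l₁_eq_lEP {I K : Mat3} (hK : K.IsSymm) (c : LPPoint 3 V3) :
    l₁ I K c = lEP I K (c.v, c.dq) := by
  simp only [l₁, lEP, Matrix.add_mulVec, Matrix.mulVec_add, dotProduct_add, add_dotProduct]
  rw [dotProduct_mulVec_comm hK c.dq c.v]
  ring

theorem l₂_eq_lEP {I K : Mat3} (hK : K.IsSymm) (c : LPPoint 0 (V3 × V3)) :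
    l₂ I K c = lEP I K c.v.swap := by
  simp only [l₂, lEP, Prod.fst_swap, Prod.snd_swap, Matrix.add_mulVec, Matrix.mulVec_add,
    dotProduct_add, add_dotProduct]
  rw [dotProduct_mulVec_comm hK c.v.1 c.v.2]
  ring

theorem dFibre_l₁ {I K : Mat3} (hI : I.IsSymm) (hK : K.IsSymm) (c : LPPoint 3 V3) (w : V3) :
    dFibre (l₁ I K) c w = w ⬝ᵥ bodyMomentum I K (c.v, c.dq) := by
  have h := (differentiable_lEP I K (c.v, c.dq)).hasFDerivAt.comp c.v
    (hasFDerivAt_prodMk_left (𝕜 := ℝ) c.v c.dq)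
  simp only [dFibre, l₁_eq_lEP hK]
  refine (congrArg (fun L => L w) h.fderiv).trans ?_
  simp [fderiv_lEP hI hK]

theorem dVel_l₁ {I K : Mat3} (hI : I.IsSymm) (hK : K.IsSymm) (c : LPPoint 3 V3) (δ : V3) :
    dVel (l₁ I K) c δ = δ ⬝ᵥ rotorMomentum K (c.v, c.dq) := by
  have h := (differentiable_lEP I K (c.v, c.dq)).hasFDerivAt.comp c.dq
    (hasFDerivAt_prodMk_right (𝕜 := ℝ) c.v c.dq)
  simp only [dVel, l₁_eq_lEP hK]
  refine (congrArg (fun L => L δ) h.fderiv).trans ?_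
  simp [fderiv_lEP hI hK]

theorem dFibre_l₂ {I K : Mat3} (hI : I.IsSymm) (hK : K.IsSymm) (c : LPPoint 0 (V3 × V3))
    (w : V3 × V3) : dFibre (l₂ I K) c w
      = w.2 ⬝ᵥ bodyMomentum I K c.v.swap + w.1 ⬝ᵥ rotorMomentum K c.v.swap := by
  have hs : HasFDerivAt (Prod.swap : V3 × V3 → V3 × V3)
      ((ContinuousLinearMap.snd ℝ V3 V3).prod (ContinuousLinearMap.fst ℝ V3 V3)) c.v :=
    ((ContinuousLinearMap.snd ℝ V3 V3).prod (ContinuousLinearMap.fst ℝ V3 V3)).hasFDerivAt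
  have h := (differentiable_lEP I K c.v.swap).hasFDerivAt.comp c.v hs
  simp only [dFibre, l₂_eq_lEP hK]
  refine (congrArg (fun L => L w) h.fderiv).trans ?_
  simp [fderiv_lEP hI hK]

/-- A balance law `p' = r` for a differentiable momentum `p` may be tested on constant vectors. In
the scalar equations differentiability is part of the claim, which is why that of `p` is assumed. -/
theorem forall_hasDerivAt_dotProduct_iff {p : ℝ → V3} {p' r : V3} {t : ℝ} (hp : HasDerivAt p p' t) :
    (∀ α : V3, HasDerivAt (fun s => α ⬝ᵥ p s) (α ⬝ᵥ r) t) ↔ p' = r := by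
  have h : ∀ α : V3, HasDerivAt (fun s => α ⬝ᵥ p s) (α ⬝ᵥ p') t := fun α => by
    simp only [dotProduct]
    exact HasDerivAt.fun_sum fun i _ => (hasDerivAt_pi.1 hp i).const_mul (α i)
  constructor
  · intro H
    refine dotProduct_eq _ _ fun u => ?_
    rw [dotProduct_comm, (h u).unique (H u), dotProduct_comm]
  · rintro rfl
    exact h

theorem hasDerivAt_mulVec (A : Mat3) {x : ℝ → V3} {x' : V3} {t : ℝ} (hx : HasDerivAt x x' t) :
    HasDerivAt (fun s => A *ᵥ x s) (A *ᵥ x') t := by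
  refine hasDerivAt_pi.2 fun i => ?_
  simp only [Matrix.mulVec, dotProduct]
  exact HasDerivAt.fun_sum fun j _ => (hasDerivAt_pi.1 hx j).const_mul (A i j)

/-- The balance of the body momentum along a curve `(Ω, Ω_r)`, tested on `α`. -/
def BodyBalance (I K : Mat3) (x : ℝ → V3 × V3) (t : ℝ) (α : V3) : Prop :=
  HasDerivAt (fun s => α ⬝ᵥ bodyMomentum I K (x s)) (α ⬝ᵥ bodyMomentum I K (x t) ⨯₃ (x t).1) t

/-- The conservation of the rotor momentum along a curve `(Ω, Ω_r)`, tested on `β`. -/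
def RotorBalance (K : Mat3) (x : ℝ → V3 × V3) (t : ℝ) (β : V3) : Prop :=
  HasDerivAt (fun s => β ⬝ᵥ rotorMomentum K (x s)) 0 t

theorem forall_bodyBalance_iff (I K : Mat3) {x : ℝ → V3 × V3} {t : ℝ}
    (h₁ : DifferentiableAt ℝ (fun s => (x s).1) t) (h₂ : DifferentiableAt ℝ (fun s => (x s).2) t) :
    (∀ α, BodyBalance I K x t α) ↔
      (I + K) *ᵥ deriv (fun s => (x s).1) t + K *ᵥ deriv (fun s => (x s).2) t
        = ((I + K) *ᵥ (x t).1 + K *ᵥ (x t).2) ⨯₃ (x t).1 :=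
  forall_hasDerivAt_dotProduct_iff
    ((hasDerivAt_mulVec (I + K) h₁.hasDerivAt).add (hasDerivAt_mulVec K h₂.hasDerivAt))

theorem forall_rotorBalance_iff (K : Mat3) {x : ℝ → V3 × V3} {t : ℝ}
    (h₁ : DifferentiableAt ℝ (fun s => (x s).1) t) (h₂ : DifferentiableAt ℝ (fun s => (x s).2) t) :
    (∀ β, RotorBalance K x t β) ↔
      K *ᵥ deriv (fun s => (x s).2) t + K *ᵥ deriv (fun s => (x s).1) t = 0 := by
  have h := forall_hasDerivAt_dotProduct_iff (r := 0)
    ((hasDerivAt_mulVec K h₂.hasDerivAt).fun_add (hasDerivAt_mulVec K h₁.hasDerivAt))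
  simpa only [RotorBalance, rotorMomentum, dotProduct_zero] using h

theorem cross_dotProduct_eq (u v p : V3) : (u ⨯₃ v) ⬝ᵥ p = v ⬝ᵥ p ⨯₃ u := by
  rw [dotProduct_comm, triple_product_permutation, triple_product_permutation]

theorem verticalEq_l₁_iff {I K : Mat3} (hI : I.IsSymm) (hK : K.IsSymm) (c : ℝ → LPPoint 3 V3)
    (t : ℝ) (α : V3) : firstLP.VerticalEq (l₁ I K) c t α ↔
      BodyBalance I K (fun s => ((c s).v, (c s).dq)) t α := by
  simp only [LPData.VerticalEq, BodyBalance, dFibre_l₁ hI hK, firstLP, zero_dotProduct, add_zero,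
    cross_dotProduct_eq]

theorem horizontalEq_l₁_iff {I K : Mat3} (hI : I.IsSymm) (hK : K.IsSymm) (c : ℝ → LPPoint 3 V3)
    (t : ℝ) (β : V3) : firstLP.HorizontalEq (l₁ I K) c t β ↔
      RotorBalance K (fun s => ((c s).v, (c s).dq)) t β := by
  have h : ∀ d : LPPoint 3 V3, torusDeriv (fun q => l₁ I K ⟨q, d.dq, d.v⟩) d.q β = 0 := fun d => by
    simp [torusDeriv, l₁]
  simp only [LPData.HorizontalEq, LPData.dBase, RotorBalance, dVel_l₁ hI hK, h,
    dFibre_l₁ hI hK, firstLP, zero_dotProduct, sub_zero]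

theorem eulerPoincareEq_lEP_iff {I K : Mat3} (hI : I.IsSymm) (hK : K.IsSymm) (x : ℝ → V3 × V3)
    (t : ℝ) (w : V3 × V3) : EulerPoincareEq fullBracket (lEP I K) x t w ↔
      HasDerivAt (fun s => w.1 ⬝ᵥ bodyMomentum I K (x s) + w.2 ⬝ᵥ rotorMomentum K (x s))
        (w.1 ⬝ᵥ bodyMomentum I K (x t) ⨯₃ (x t).1) t := by
  simp only [EulerPoincareEq, fderiv_lEP hI hK, fullBracket, zero_dotProduct, add_zero,
    cross_dotProduct_eq]

theorem eulerPoincareEq_lEP_body_iff {I K : Mat3} (hI : I.IsSymm) (hK : K.IsSymm)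
    (x : ℝ → V3 × V3) (t : ℝ) (α : V3) :
    EulerPoincareEq fullBracket (lEP I K) x t (α, 0) ↔ BodyBalance I K x t α := by
  simp only [eulerPoincareEq_lEP_iff hI hK, BodyBalance, zero_dotProduct, add_zero]

theorem eulerPoincareEq_lEP_rotor_iff {I K : Mat3} (hI : I.IsSymm) (hK : K.IsSymm)
    (x : ℝ → V3 × V3) (t : ℝ) (β : V3) :
    EulerPoincareEq fullBracket (lEP I K) x t (0, β) ↔ RotorBalance K x t β := by
  simp only [eulerPoincareEq_lEP_iff hI hK, RotorBalance, zero_dotProduct, zero_add]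

theorem forall_eulerPoincareEq_lEP_iff {I K : Mat3} (hI : I.IsSymm) (hK : K.IsSymm)
    (x : ℝ → V3 × V3) (t : ℝ) : (∀ w, EulerPoincareEq fullBracket (lEP I K) x t w) ↔
      (∀ α, BodyBalance I K x t α) ∧ ∀ β, RotorBalance K x t β := by
  refine ⟨fun h => ⟨fun α => (eulerPoincareEq_lEP_body_iff hI hK x t α).1 (h _),
    fun β => (eulerPoincareEq_lEP_rotor_iff hI hK x t β).1 (h _)⟩, fun h w => ?_⟩
  rw [eulerPoincareEq_lEP_iff hI hK]
  simpa only [add_zero] using (h.1 w.1).fun_add (h.2 w.2)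

/-! ### The flat connection on `SO(3) × 𝕋³` -/

theorem SO3.transpose_mul_self (g : SO3) : (g : Mat3)ᵀ * (g : Mat3) = 1 := by
  rw [← coe_inv, ← Submonoid.coe_mul, inv_mul_cancel, Submonoid.coe_one]

theorem SO3.mul_transpose_self (g : SO3) : (g : Mat3) * (g : Mat3)ᵀ = 1 := by
  rw [← coe_inv, ← Submonoid.coe_mul, mul_inv_cancel, Submonoid.coe_one]

theorem hat_injective : Function.Injective hat := Function.LeftInverse.injective vee_hat

theorem hat_bodyVel (v : TConfig) :
    hat (bodyVel v) = ((v.base.R : Mat3))ᵀ * (v.vec : Mat3 × V3).1 := by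
  rw [bodyVel, hat_vee (mem_tangentAt.1 v.vec.2), coe_inv]

/-- `Ṙ = R Ω`. -/
theorem mul_hat_bodyVel (v : TConfig) :
    (v.base.R : Mat3) * hat (bodyVel v) = (v.vec : Mat3 × V3).1 := by
  rw [hat_bodyVel, ← Matrix.mul_assoc, SO3.mul_transpose_self, Matrix.one_mul]

theorem maurerCartan_eq (v : TConfig) : maurerCartan v.base v.vec = Ad v.base.R (bodyVel v) := by
  rw [Ad, mul_hat_bodyVel]
  rfl

/-- `Ṙ = A(Ṙ, θ̇) R`. -/
theorem hat_maurerCartan_mul (v : TConfig) :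
    hat (maurerCartan v.base v.vec) * (v.base.R : Mat3) = (v.vec : Mat3 × V3).1 := by
  rw [maurerCartan_eq, hat_Ad, coe_inv, Matrix.mul_assoc, SO3.transpose_mul_self, Matrix.mul_one,
    mul_hat_bodyVel]

theorem maurerCartan_smooth : maurerCartan.Smooth := by
  -- `(N, y) ↦ vee (N Mᵀ)` at `(M, x)`, which is linear in `M`
  let B₀ : Ambient →ₗ[ℝ] Ambient →ₗ[ℝ] V3 := LinearMap.mk₂ ℝ
    (fun p q => vee (Matrix.of q.1 * (Matrix.of p.1)ᵀ))
    (by intros; ext i; fin_cases i <;> simp [vee, Matrix.mul_apply, Fin.sum_univ_three] <;> ring)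
    (by intros; ext i; fin_cases i <;> simp [vee, Matrix.mul_apply, Fin.sum_univ_three] <;> ring)
    (by intros; ext i; fin_cases i <;> simp [vee, Matrix.mul_apply, Fin.sum_univ_three] <;> ring)
    (by intros; ext i; fin_cases i <;> simp [vee, Matrix.mul_apply, Fin.sum_univ_three] <;> ring)
  exact ⟨B₀.toContinuousBilinearMap, B₀.toContinuousBilinearMap.contDiff, fun R x v => rfl⟩

theorem maurerCartan_isPrincipalConnection : IsPrincipalConnection maurerCartan where
  smooth := maurerCartan_smooth
  vertical ξ q := by
    change vee (hat ξ * (q.R : Mat3) * ((q.R⁻¹ : SO3) : Mat3)) = ξ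
    rw [coe_inv, Matrix.mul_assoc, SO3.mul_transpose_self, Matrix.mul_one, vee_hat]
  equivariant g q v := by
    apply hat_injective
    have e := hat_maurerCartan_mul ⟨q, v⟩
    have e' := hat_maurerCartan_mul ⟨g • q, liftVec g v⟩
    change _ = (g : Mat3) * (v : Mat3 × V3).1 at e'
    change _ = (v : Mat3 × V3).1 at e
    rw [← e] at e'
    change hat (maurerCartan (g • q) (liftVec g v)) * ((g * q.R : SO3) : Mat3)
      = (g : Mat3) * (hat (maurerCartan q v) * (q.R : Mat3)) at e'
    have e'' := congrArg (fun N => N * (((g * q.R)⁻¹ : SO3) : Mat3)) e'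
    simp only [coe_inv, Matrix.mul_assoc, SO3.mul_transpose_self, Matrix.mul_one] at e''
    rw [e'', hat_Ad, coe_inv, Submonoid.coe_mul, Matrix.transpose_mul]
    simp only [Matrix.mul_assoc]
    rw [← Matrix.mul_assoc (q.R : Mat3), SO3.mul_transpose_self, Matrix.one_mul]

theorem hor_maurerCartan (q : Config) (v : tangentAt q) :
    (hor maurerCartan q v : Mat3 × V3) = (0, (v : Mat3 × V3).2) := by
  have e := hat_maurerCartan_mul ⟨q, v⟩
  refine Prod.ext ?_ ?_
  · change (v : Mat3 × V3).1 - hat (maurerCartan q v) * (q.R : Mat3) = 0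
    rw [e, sub_self]
  · change (v : Mat3 × V3).2 - 0 = _
    rw [sub_zero]

theorem hasDerivAt_apply_of_differentiableAt {E W : Type*} [NormedAddCommGroup E] [NormedSpace ℝ E]
    [NormedAddCommGroup W] [NormedSpace ℝ W] {B : E → E →L[ℝ] W} {p : E}
    (hB : DifferentiableAt ℝ B p) (u w : E) :
    HasDerivAt (fun s : ℝ => B (p + s • u) w) (fderiv ℝ B p u w) 0 := by
  have hl : HasDerivAt (fun s : ℝ => p + s • u) u 0 := by
    simpa using ((hasDerivAt_id (0 : ℝ)).smul_const u).const_add p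
  have hd : HasFDerivAt B (fderiv ℝ B p) (p + (0 : ℝ) • u) := by
    simpa using hB.hasFDerivAt
  exact (ContinuousLinearMap.apply ℝ W w).hasFDerivAt.comp_hasDerivAt 0 (hd.comp_hasDerivAt 0 hl)

/-- Horizontal vectors are those along the torus. The derivative of an extension `B` in such a
direction is taken along a curve `(R, x + s y)`, which stays in `SO(3) × ℝ³`; there `B` agrees with
the connection form, which vanishes on vectors along the torus. -/
theorem fderiv_extension_maurerCartan {B : Ambient → (Ambient →L[ℝ] V3)}
    (hB : IsSmoothExtension maurerCartan B) (R : SO3) (x y z : V3) :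
    fderiv ℝ B (toAmbient ((R : Mat3), x)) (toAmbient (0, y)) (toAmbient (0, z)) = 0 := by
  have h₁ := hasDerivAt_apply_of_differentiableAt
    (hB.1.differentiable (by simp) (toAmbient ((R : Mat3), x))) (toAmbient (0, y))
    (toAmbient (0, z))
  have h₂ : ∀ s : ℝ,
      B (toAmbient ((R : Mat3), x) + s • toAmbient (0, y)) (toAmbient (0, z)) = 0 := by
    intro s
    have e : toAmbient ((R : Mat3), x) + s • toAmbient (0, y)
        = toAmbient ((R : Mat3), x + s • y) := by
      refine Prod.ext ?_ rfl
      funext i j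
      simp [toAmbient]
    have hz : ((0, z) : Mat3 × V3) ∈ tangentAt ⟨R, toTorus (x + s • y)⟩ := by
      rw [mem_tangentAt]
      simp
    have h₃ : maurerCartan ⟨R, toTorus (x + s • y)⟩ ⟨(0, z), hz⟩ = 0 := by
      ext i
      fin_cases i <;> simp [maurerCartan, vee]
    rw [e]
    exact (hB.2 R (x + s • y) ⟨(0, z), hz⟩).trans h₃
  simp only [h₂] at h₁
  exact h₁.unique (hasDerivAt_const _ _)

theorem curvature_maurerCartan (q : Config) (v w : tangentAt q) :
    curvature maurerCartan q v w = 0 := by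
  rw [curvature, OneForm.extDeriv]
  split_ifs with h
  · rw [hor_maurerCartan, hor_maurerCartan, fderiv_extension_maurerCartan h.choose_spec,
      fderiv_extension_maurerCartan h.choose_spec, sub_zero]
  · rfl

/-! ### The first reduced bundle -/

theorem SO3.smul_eq_self {g : SO3} {q : Config} (h : g • q = q) : g = 1 :=
  mul_eq_right.1 (congrArg Config.R h)

theorem Config.torus_eq_iff (q q' : Config) : q.θ = q'.θ ↔ ∃ g : SO3, g • q = q' := by
  constructor
  · intro h
    exact ⟨q'.R * q.R⁻¹, Config.ext (inv_mul_cancel_right q'.R q.R) h⟩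
  · rintro ⟨g, rfl⟩
    rfl

theorem adjTriv_adjMk (q : Config) (ξ : V3) : adjTriv (adjMk q ξ) = (q.θ, Ad q.R⁻¹ ξ) := rfl

theorem adjTriv_injective : Function.Injective adjTriv := by
  intro e e'
  induction e using Quotient.inductionOn with | _ p
  induction e' using Quotient.inductionOn with | _ p'
  intro h
  change ((p.q.θ, Ad p.q.R⁻¹ p.ξ) : Torus 3 × V3) = (p'.q.θ, Ad p'.q.R⁻¹ p'.ξ) at h
  obtain ⟨h₁, h₂⟩ := Prod.ext_iff.1 h
  refine Quotient.sound ⟨p.q.R * p'.q.R⁻¹, ConfigLie.ext ?_ ?_⟩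
  · exact Config.ext (inv_mul_cancel_right p.q.R p'.q.R) h₁.symm
  · change Ad (p.q.R * p'.q.R⁻¹) p'.ξ = p.ξ
    simp only at h₂
    rw [Ad_mul, ← h₂, ← Ad_mul, mul_inv_cancel, Ad_one]

theorem trivialise_injective : Function.Injective trivialise := by
  intro p p' h
  obtain ⟨⟨⟨θ, y⟩, e⟩, he⟩ := p
  obtain ⟨⟨⟨θ', y'⟩, e'⟩, he'⟩ := p'
  obtain ⟨h₁, h₂, h₃⟩ := LPPoint.ext_iff.1 h
  simp only [trivialise] at h₁ h₂ h₃ he he'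
  subst h₁ h₂
  obtain rfl : e = e' := adjTriv_injective (Prod.ext (he.trans he'.symm) h₃)
  rfl

theorem trivialise_connectionMap (v : TConfig) :
    trivialise (connectionMap maurerCartan v) = ⟨v.base.θ, rotorVel v, bodyVel v⟩ := by
  refine LPPoint.ext rfl rfl ?_
  change Ad v.base.R⁻¹ (maurerCartan v.base v.vec) = bodyVel v
  rw [maurerCartan_eq, ← Ad_mul, inv_mul_cancel, Ad_one]

/-- Such a tangent vector exists at the identity rotation. -/
theorem exists_bodyVel_rotorVel (θ : Torus 3) (y a : V3) :
    ∃ v : TConfig, v.base.θ = θ ∧ rotorVel v = y ∧ bodyVel v = a := by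
  refine ⟨⟨⟨1, θ⟩, ⟨(hat a, y), ?_⟩⟩, rfl, rfl, ?_⟩
  · rw [mem_tangentAt]
    simp [hat_skew]
  · simp [bodyVel, vee_hat]

theorem exists_trivialise_connectionMap (c : LPPoint 3 V3) :
    ∃ v : TConfig, trivialise (connectionMap maurerCartan v) = c := by
  obtain ⟨v, h₁, h₂, h₃⟩ := exists_bodyVel_rotorVel c.q c.dq c.v
  exact ⟨v, by rw [trivialise_connectionMap, h₁, h₂, h₃]⟩

theorem trivialise_bijective : Function.Bijective trivialise :=
  ⟨trivialise_injective, fun c =>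
    (exists_trivialise_connectionMap c).elim fun _ hv => ⟨_, hv⟩⟩

theorem connectionMap_surjective : Function.Surjective (connectionMap maurerCartan) := fun p =>
  let ⟨v, hv⟩ := exists_trivialise_connectionMap (trivialise p)
  ⟨v, trivialise_injective hv⟩

theorem bodyVel_smul (g : SO3) (v : TConfig) : bodyVel (g • v) = bodyVel v := by
  change vee ((((g * v.base.R)⁻¹ : SO3) : Mat3) * ((g : Mat3) * (v.vec : Mat3 × V3).1)) = _
  rw [← Matrix.mul_assoc, ← Submonoid.coe_mul, _root_.mul_inv_rev, inv_mul_cancel_right]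
  rfl

theorem rotorVel_smul (g : SO3) (v : TConfig) : rotorVel (g • v) = rotorVel v := rfl

theorem connectionMap_eq_iff (v w : TConfig) :
    connectionMap maurerCartan v = connectionMap maurerCartan w ↔ ∃ g : SO3, g • v = w := by
  rw [← trivialise_injective.eq_iff, trivialise_connectionMap, trivialise_connectionMap,
    LPPoint.mk.injEq]
  constructor
  · rintro ⟨h₁, h₂, h₃⟩
    have hR : w.base.R * v.base.R⁻¹ * v.base.R = w.base.R := inv_mul_cancel_right _ _
    refine ⟨w.base.R * v.base.R⁻¹, TConfig.ext' (Config.ext hR h₁) (Prod.ext ?_ h₂)⟩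
    change ((w.base.R * v.base.R⁻¹ : SO3) : Mat3) * (v.vec : Mat3 × V3).1 = (w.vec : Mat3 × V3).1
    rw [← mul_hat_bodyVel v, ← mul_hat_bodyVel w, ← Matrix.mul_assoc, ← Submonoid.coe_mul, hR, h₃]
  · rintro ⟨g, rfl⟩
    exact ⟨rfl, rfl, (bodyVel_smul g v).symm⟩

theorem lagrangian_smul (I K : Mat3) (g : SO3) (v : TConfig) :
    lagrangian I K (g • v) = lagrangian I K v := by
  simp only [lagrangian, bodyVel_smul, rotorVel_smul]

theorem Ad_cross (g : SO3) (a b : V3) : Ad g (a ⨯₃ b) = Ad g a ⨯₃ Ad g b := by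
  apply hat_injective
  have e : ∀ X Y : Mat3, (g : Mat3) * X * (g : Mat3)ᵀ * ((g : Mat3) * Y * (g : Mat3)ᵀ)
      = (g : Mat3) * (X * Y) * (g : Mat3)ᵀ := fun X Y => by
    simp only [Matrix.mul_assoc]
    rw [← Matrix.mul_assoc (g : Mat3)ᵀ (g : Mat3), SO3.transpose_mul_self, Matrix.one_mul]
  rw [hat_Ad, hat_cross, hat_cross, hat_Ad, hat_Ad, coe_inv, e, e, Matrix.mul_sub, Matrix.sub_mul]

theorem Ad_zero (g : SO3) : Ad g 0 = 0 := by
  have h := Ad_cross g 0 0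
  rwa [cross_self, cross_self] at h

theorem hasDerivAt_matrix_mul {X Y : ℝ → Mat3} {X' Y' : Mat3} {t : ℝ}
    (hX : ∀ i j, HasDerivAt (fun s => X s i j) (X' i j) t)
    (hY : ∀ i j, HasDerivAt (fun s => Y s i j) (Y' i j) t) (i j : Fin 3) :
    HasDerivAt (fun s => (X s * Y s) i j) ((X' * Y t + X t * Y') i j) t := by
  simp only [Matrix.add_apply, Matrix.mul_apply, ← Finset.sum_add_distrib]
  exact HasDerivAt.fun_sum fun k _ => (hX i k).mul (hY k j)

theorem hasDerivAt_vee {X : ℝ → Mat3} {X' : Mat3} {t : ℝ}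
    (hX : ∀ i j, HasDerivAt (fun s => X s i j) (X' i j) t) :
    HasDerivAt (fun s => vee (X s)) (vee X') t := by
  refine hasDerivAt_pi.2 fun i => ?_
  fin_cases i
  · exact hX 2 1
  · exact hX 0 2
  · exact hX 1 0

theorem hasDerivAt_hat {a : ℝ → V3} {a' : V3} {t : ℝ} (ha : HasDerivAt a a' t) (i j : Fin 3) :
    HasDerivAt (fun s => hat (a s) i j) (hat a' i j) t := by
  have h := hasDerivAt_pi.1 ha
  fin_cases i <;> fin_cases j <;> simp [hat] <;>
    first
      | exact hasDerivAt_const _ _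
      | exact h _
      | exact (h _).neg

/-- `d/dt Ad_{R⁻¹} ξ = Ad_{R⁻¹} (ξ' - A × ξ)` where `Ṙ = A R`. -/
theorem hasDerivAt_Ad_inv {R : ℝ → SO3} {ξ : ℝ → V3} {t : ℝ} {A ξ' : V3}
    (hR : ∀ i j, HasDerivAt (fun s => (R s : Mat3) i j) ((hat A * (R t : Mat3)) i j) t)
    (hξ : HasDerivAt ξ ξ' t) :
    HasDerivAt (fun s => Ad (R s)⁻¹ (ξ s)) (Ad (R t)⁻¹ (ξ' - A ⨯₃ ξ t)) t := by
  have hT : ∀ i j, HasDerivAt (fun s => ((R s : Mat3)ᵀ) i j) (((hat A * (R t : Mat3))ᵀ) i j) t :=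
    fun i j => hR j i
  have h := hasDerivAt_vee (hasDerivAt_matrix_mul (hasDerivAt_matrix_mul hT (hasDerivAt_hat hξ)) hR)
  have hsub : hat (ξ' - A ⨯₃ ξ t) = hat ξ' - hat (A ⨯₃ ξ t) := by
    ext i j
    fin_cases i <;> fin_cases j <;> simp [hat] <;> ring
  have e : Ad (R t)⁻¹ (ξ' - A ⨯₃ ξ t) = vee (((hat A * (R t : Mat3))ᵀ * hat (ξ t)
      + (R t : Mat3)ᵀ * hat ξ') * (R t : Mat3) + (R t : Mat3)ᵀ * hat (ξ t)
        * (hat A * (R t : Mat3))) := by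
    rw [Ad, inv_inv, coe_inv, hsub, hat_cross, Matrix.transpose_mul, hat_skew]
    congr 1
    noncomm_ring
  rw [e]
  simpa only [Ad, inv_inv, coe_inv] using h

theorem maurerCartan_isAdjointStructure : IsAdjointStructure maurerCartan firstLP where
  bracket q ξ η := Ad_cross q.R⁻¹ ξ η
  form q X Y := by
    rw [curvature_maurerCartan, adjTriv_adjMk]
    exact Ad_zero _
  conn q ξ t v ξ' hq hξ := by
    refine ⟨_, hasDerivAt_Ad_inv (A := maurerCartan (q t) v) (fun i j => ?_) hξ, ?_⟩
    · rw [hat_maurerCartan_mul ⟨q t, v⟩]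
      exact hq.1 i j
    · exact (add_zero _).symm

/-! ### Uniqueness of the reduced Lagrangians and reduction by the torus -/

theorem eq_of_comp_eq_iff {α β γ : Type*} {π : α → β} (hπ : Function.Surjective π) {L : α → γ}
    {l₀ : β → γ} (h₀ : ∀ a, l₀ (π a) = L a) (l : β → γ) : (∀ a, l (π a) = L a) ↔ l = l₀ := by
  constructor
  · intro h
    funext b
    obtain ⟨a, rfl⟩ := hπ b
    rw [h, h₀]
  · rintro rfl
    exact h₀

theorem lagrangian_eq_lEP (I K : Mat3) (v : TConfig) :
    lagrangian I K v = lEP I K (bodyVel v, rotorVel v) := rfl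

theorem torusConnection_isTorusConnection : IsTorusConnection torusConnection where
  smooth _ := contDiff_const
  vertical _ _ := rfl
  equivariant _ _ := rfl

theorem torusQuotientMap_eq_iff (c d : LPPoint 3 V3) :
    torusQuotientMap torusConnection c = torusQuotientMap torusConnection d ↔
      ∃ φ : Torus 3, φ +ᵥ c = d := by
  constructor
  · intro h
    obtain ⟨h₁, h₂⟩ := Prod.ext_iff.1 (LPPoint.ext_iff.1 h).2.2
    exact ⟨d.q - c.q, LPPoint.ext (add_sub_cancel c.q d.q) h₁ h₂⟩
  · rintro ⟨φ, rfl⟩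
    rfl

theorem torusQuotientMap_surjective :
    Function.Surjective (torusQuotientMap (F := V3) torusConnection) := fun d =>
  ⟨⟨0, d.v.1, d.v.2⟩, LPPoint.ext (Subsingleton.elim _ _) (Subsingleton.elim _ _) rfl⟩

theorem torus_vadd_eq_self {φ : Torus 3} {c : LPPoint 3 V3} (h : φ +ᵥ c = c) : φ = 0 :=
  add_eq_left.1 (congrArg LPPoint.q h)

/-- Over a point there are no directions in which the horizontal equation could be tested. -/
theorem horizontalEq_point {F : Type} [NormedAddCommGroup F] [NormedSpace ℝ F] {P : LPData 0 F}
    (hf : P.form = 0) (hc : P.conn = 0) (L : LPPoint 0 F → ℝ) (c : ℝ → LPPoint 0 F) (t : ℝ)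
    (δ : Fin 0 → ℝ) : P.HorizontalEq L c t δ := by
  obtain rfl : δ = 0 := Subsingleton.elim _ _
  simp only [LPData.HorizontalEq, LPData.dBase, dVel, torusDeriv, dFibre, hf, hc, Pi.zero_apply,
    map_zero, sub_zero]
  exact hasDerivAt_const t 0

/-- The two sides carry the summands `𝔰𝔬(3)` and `ℝ³` in opposite orders, hence the swaps. -/
theorem verticalEq_l₂_iff {I K : Mat3} (hI : I.IsSymm) (hK : K.IsSymm)
    (c : ℝ → LPPoint 0 (V3 × V3)) (t : ℝ) (w : V3 × V3) :
    firstLP.torusReduction.VerticalEq (l₂ I K) c t w ↔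
      EulerPoincareEq fullBracket (lEP I K) (fun s => (c s).v.swap) t w.swap := by
  rw [eulerPoincareEq_lEP_iff hI hK, torusReduction_firstLP]
  simp only [LPData.VerticalEq, dFibre_l₂ hI hK, Pi.zero_apply, Prod.fst_zero, Prod.snd_zero,
    zero_dotProduct, add_zero, cross_dotProduct_eq, Prod.fst_swap, Prod.snd_swap]

theorem forall_verticalEq_l₂_iff {I K : Mat3} (hI : I.IsSymm) (hK : K.IsSymm)
    (c : ℝ → LPPoint 0 (V3 × V3)) (t : ℝ) :
    (∀ w, firstLP.torusReduction.VerticalEq (l₂ I K) c t w) ↔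
      ∀ w, EulerPoincareEq fullBracket (lEP I K) (fun s => (c s).v.swap) t w := by
  simp only [verticalEq_l₂_iff hI hK]
  exact Prod.swap_surjective.forall.symm

theorem verticalEq_l₂_body_iff {I K : Mat3} (hI : I.IsSymm) (hK : K.IsSymm)
    (c : ℝ → LPPoint 0 (V3 × V3)) (t : ℝ) (α : V3) :
    firstLP.torusReduction.VerticalEq (l₂ I K) c t (0, α) ↔
      BodyBalance I K (fun s => (c s).v.swap) t α :=
  (verticalEq_l₂_iff hI hK c t (0, α)).trans (eulerPoincareEq_lEP_body_iff hI hK _ t α)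

theorem verticalEq_l₂_rotor_iff {I K : Mat3} (hI : I.IsSymm) (hK : K.IsSymm)
    (c : ℝ → LPPoint 0 (V3 × V3)) (t : ℝ) (β : V3) :
    firstLP.torusReduction.VerticalEq (l₂ I K) c t (β, 0) ↔
      RotorBalance K (fun s => (c s).v.swap) t β :=
  (verticalEq_l₂_iff hI hK c t (β, 0)).trans (eulerPoincareEq_lEP_rotor_iff hI hK _ t β)

theorem isAdmissibleOn_torusQuotientMap {J : Set ℝ} {c : ℝ → LPPoint 3 V3}
    (hc : IsAdmissibleOn J c) :
    IsAdmissibleOn J (fun s => torusQuotientMap torusConnection (c s)) := fun t ht =>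
  ⟨⟨fun _ => 0, hasDerivAt_const t 0, Filter.Eventually.of_forall fun _ => Subsingleton.elim _ _⟩,
    differentiableAt_const _, (hc t ht).2.1.prodMk (hc t ht).2.2⟩

theorem isAdmissibleOn_trivialise_connectionMap {J : Set ℝ} {V : ℝ → TConfig}
    (hV : ∀ t ∈ J, HasConfigVelocityAt (fun s => (V s).base) (V t).vec t ∧
      DifferentiableAt ℝ (fun s => bodyVel (V s)) t ∧
      DifferentiableAt ℝ (fun s => rotorVel (V s)) t) :
    IsAdmissibleOn J (fun s => trivialise (connectionMap maurerCartan (V s))) := by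
  intro t ht
  obtain ⟨h₁, h₂, h₃⟩ := hV t ht
  simp only [trivialise_connectionMap]
  exact ⟨h₁.2, h₃, h₂⟩

end RotorBody

theorem mainTheorem3 (I K : Mat3) (hI : I.IsSymm) (hK : K.IsSymm) :
    -- the principal bundle `SO(3) × 𝕋³ → 𝕋³` and its flat Maurer–Cartan connection
    ((∀ (g : SO3) (q : Config), g • q = q → g = 1) ∧
      (∀ q q' : Config, q.θ = q'.θ ↔ ∃ g : SO3, g • q = q') ∧
      IsPrincipalConnection maurerCartan ∧
      (∀ v : TConfig, maurerCartan v.base v.vec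
        = Ad v.base.R (bodyVel v)) ∧
      (∀ (q : Config) (v w : tangentAt q),
        curvature maurerCartan q v w = 0)) ∧
    -- the first reduced bundle, its trivialisation and its Lagrange–Poincaré structure
    ((∀ v w : TConfig, connectionMap maurerCartan v
          = connectionMap maurerCartan w ↔
            ∃ g : SO3, g • v = w) ∧
      Function.Surjective (connectionMap maurerCartan) ∧
      Function.Bijective trivialise ∧
      (∀ v : TConfig,
        trivialise (connectionMap maurerCartan v)
          = ⟨v.base.θ, rotorVel v, bodyVel v⟩) ∧
      IsAdjointStructure maurerCartan firstLP ∧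
      firstLP.IsLPBundle) ∧
    -- the first reduced Lagrangian
    ((∀ (g : SO3) (v : TConfig),
        lagrangian I K (g • v) = lagrangian I K v) ∧
      (∀ l : LPPoint 3 V3 → ℝ,
        (∀ v : TConfig,
          l (trivialise (connectionMap maurerCartan v))
            = lagrangian I K v) ↔ l = l₁ I K)) ∧
    -- the Lagrange–Poincaré equations of the first step
    (∀ (J : Set ℝ) (c : ℝ → LPPoint 3 V3), IsAdmissibleOn J c →
      ∀ t ∈ J,
        ((∀ α, firstLP.VerticalEq (l₁ I K) c t α) ↔
          (I + K) *ᵥ deriv (fun s => (c s).v) t + K *ᵥ deriv (fun s => (c s).dq) t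
            = ((I + K) *ᵥ (c t).v + K *ᵥ (c t).dq) ⨯₃ (c t).v) ∧
        ((∀ β, firstLP.HorizontalEq (l₁ I K) c t β) ↔
          K *ᵥ deriv (fun s => (c s).dq) t + K *ᵥ deriv (fun s => (c s).v) t = 0)) ∧
    -- the second step: the action, the connection, the reduced bundle and its structure
    ((∀ (φ : Torus 3) (c : LPPoint 3 V3), φ +ᵥ c = c → φ = 0) ∧
      firstLP.TorusInvariant ∧
      IsTorusConnection torusConnection ∧
      (∀ c d : LPPoint 3 V3,
        torusQuotientMap torusConnection c
          = torusQuotientMap torusConnection d ↔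
            ∃ φ : Torus 3, φ +ᵥ c = d) ∧
      Function.Surjective
        (torusQuotientMap (F := V3) torusConnection) ∧
      firstLP.torusReduction
        = { bracket := fun _ a b => (0, a.2 ⨯₃ b.2), form := 0, conn := 0 } ∧
      firstLP.torusReduction.IsLPBundle) ∧
    -- the second reduced Lagrangian
    ((∀ (φ : Torus 3) (c : LPPoint 3 V3),
        l₁ I K (φ +ᵥ c) = l₁ I K c) ∧
      (∀ l : LPPoint 0 (V3 × V3) → ℝ,
        (∀ c : LPPoint 3 V3,
          l (torusQuotientMap torusConnection c) = l₁ I K c) ↔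
            l = l₂ I K)) ∧
    -- the Lagrange–Poincaré equations of the second step
    (∀ (J : Set ℝ) (c : ℝ → LPPoint 0 (V3 × V3)),
      IsAdmissibleOn J c → ∀ t ∈ J,
        (∀ δ, firstLP.torusReduction.HorizontalEq (l₂ I K) c t δ) ∧
        ((∀ α, firstLP.torusReduction.VerticalEq (l₂ I K) c t (0, α)) ↔
          (I + K) *ᵥ deriv (fun s => (c s).v.2) t + K *ᵥ deriv (fun s => (c s).v.1) t
            = ((I + K) *ᵥ (c t).v.2 + K *ᵥ (c t).v.1) ⨯₃ (c t).v.2) ∧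
        ((∀ β, firstLP.torusReduction.VerticalEq (l₂ I K) c t (β, 0)) ↔
          K *ᵥ deriv (fun s => (c s).v.1) t + K *ᵥ deriv (fun s => (c s).v.2) t = 0) ∧
        ((∀ w, firstLP.torusReduction.VerticalEq (l₂ I K) c t w) ↔
          (I + K) *ᵥ deriv (fun s => (c s).v.2) t + K *ᵥ deriv (fun s => (c s).v.1) t
            = ((I + K) *ᵥ (c t).v.2 + K *ᵥ (c t).v.1) ⨯₃ (c t).v.2 ∧
          K *ᵥ deriv (fun s => (c s).v.1) t + K *ᵥ deriv (fun s => (c s).v.2) t = 0)) ∧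
    -- Euler–Poincaré reduction
    ((∀ l : V3 × V3 → ℝ,
        (∀ v : TConfig, l (bodyVel v, rotorVel v)
          = lagrangian I K v) ↔ l = lEP I K) ∧
      (∀ (x : ℝ → V3 × V3) (t : ℝ), DifferentiableAt ℝ x t →
        ((∀ α, EulerPoincareEq fullBracket (lEP I K) x t (α, 0)) ↔
          (I + K) *ᵥ deriv (fun s => (x s).1) t + K *ᵥ deriv (fun s => (x s).2) t
            = ((I + K) *ᵥ (x t).1 + K *ᵥ (x t).2) ⨯₃ (x t).1) ∧
        ((∀ β, EulerPoincareEq fullBracket (lEP I K) x t (0, β)) ↔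
          K *ᵥ deriv (fun s => (x s).2) t + K *ᵥ deriv (fun s => (x s).1) t = 0))) ∧
    -- the reductions of a motion of the system are admissible curves
    (∀ (J : Set ℝ) (V : ℝ → TConfig),
      (∀ t ∈ J, HasConfigVelocityAt (fun s => (V s).base) (V t).vec t ∧
        DifferentiableAt ℝ (fun s => bodyVel (V s)) t ∧
        DifferentiableAt ℝ (fun s => rotorVel (V s)) t) →
      IsAdmissibleOn J
        (fun s => trivialise
          (connectionMap maurerCartan (V s)))) ∧
    -- equivalence of the equations of both steps with the Euler–Poincaré equations
    (∀ (J : Set ℝ) (c : ℝ → LPPoint 3 V3), IsAdmissibleOn J c →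
      IsAdmissibleOn J
        (fun s => torusQuotientMap torusConnection (c s)) ∧
      ∀ t ∈ J,
        -- each equation of the first step is a component of the Euler–Poincaré equations
        (∀ α, firstLP.VerticalEq (l₁ I K) c t α ↔
          EulerPoincareEq fullBracket (lEP I K)
            (fun s => ((c s).v, (c s).dq)) t (α, 0)) ∧
        (∀ β, firstLP.HorizontalEq (l₁ I K) c t β ↔
          EulerPoincareEq fullBracket (lEP I K)
            (fun s => ((c s).v, (c s).dq)) t (0, β)) ∧
        -- each equation of the first step is a component of the vertical one of the second
        (∀ α, firstLP.VerticalEq (l₁ I K) c t α ↔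
          firstLP.torusReduction.VerticalEq (l₂ I K)
            (fun s => torusQuotientMap torusConnection (c s)) t (0, α)) ∧
        (∀ β, firstLP.HorizontalEq (l₁ I K) c t β ↔
          firstLP.torusReduction.VerticalEq (l₂ I K)
            (fun s => torusQuotientMap torusConnection (c s)) t (β, 0)) ∧
        -- the three systems are equivalent
        (((∀ α, firstLP.VerticalEq (l₁ I K) c t α) ∧
            ∀ β, firstLP.HorizontalEq (l₁ I K) c t β) ↔
          ∀ w, EulerPoincareEq fullBracket (lEP I K)
            (fun s => ((c s).v, (c s).dq)) t w) ∧
        ((∀ w, firstLP.torusReduction.VerticalEq (l₂ I K)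
            (fun s => torusQuotientMap torusConnection (c s)) t w) ↔
          ∀ w, EulerPoincareEq fullBracket (lEP I K)
            (fun s => ((c s).v, (c s).dq)) t w)) := by
  have hsurj : Function.Surjective fun v : TConfig => (bodyVel v, rotorVel v) := fun x =>
    let ⟨v, _, h₂, h₁⟩ := exists_bodyVel_rotorVel 0 x.2 x.1
    ⟨v, Prod.ext h₁ h₂⟩
  refine ⟨⟨fun g q => SO3.smul_eq_self, Config.torus_eq_iff, maurerCartan_isPrincipalConnection,
    maurerCartan_eq, curvature_maurerCartan⟩, ⟨connectionMap_eq_iff, connectionMap_surjective,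
    trivialise_bijective, trivialise_connectionMap, maurerCartan_isAdjointStructure,
    firstLP_isLPBundle⟩, ⟨lagrangian_smul I K, ?_⟩, ?_, ⟨fun φ c => torus_vadd_eq_self,
    fun _ _ => ⟨rfl, rfl, rfl⟩, torusConnection_isTorusConnection, torusQuotientMap_eq_iff,
    torusQuotientMap_surjective, torusReduction_firstLP, torusReduction_firstLP_isLPBundle⟩,
    ⟨fun _ _ => rfl, ?_⟩, ?_, ⟨?_, ?_⟩, fun J V => isAdmissibleOn_trivialise_connectionMap, ?_⟩
  · refine eq_of_comp_eq_iff (trivialise_bijective.2.comp connectionMap_surjective) fun v => ?_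
    rw [Function.comp_apply, trivialise_connectionMap, l₁_eq_lEP hK, lagrangian_eq_lEP]
  · intro J c hc t ht
    obtain ⟨-, h₁, h₂⟩ := hc t ht
    simp only [verticalEq_l₁_iff hI hK, horizontalEq_l₁_iff hI hK]
    exact ⟨forall_bodyBalance_iff I K h₂ h₁, forall_rotorBalance_iff K h₂ h₁⟩
  · refine eq_of_comp_eq_iff torusQuotientMap_surjective fun c => ?_
    rw [l₂_eq_lEP hK, l₁_eq_lEP hK]
    rfl
  · intro J c hc t ht
    obtain ⟨-, -, h⟩ := hc t ht
    have b := forall_bodyBalance_iff I K (x := fun s => (c s).v.swap) h.snd h.fst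
    have r := forall_rotorBalance_iff K (x := fun s => (c s).v.swap) h.snd h.fst
    refine ⟨fun δ => horizontalEq_point (by rw [torusReduction_firstLP])
      (by rw [torusReduction_firstLP]) _ c t δ, ?_, ?_, ?_⟩
    · simp only [verticalEq_l₂_body_iff hI hK]
      exact b
    · simp only [verticalEq_l₂_rotor_iff hI hK]
      exact r
    · rw [forall_verticalEq_l₂_iff hI hK, forall_eulerPoincareEq_lEP_iff hI hK]
      exact and_congr b r
  · exact eq_of_comp_eq_iff hsurj fun v => rfl
  · intro x t hx
    simp only [eulerPoincareEq_lEP_body_iff hI hK, eulerPoincareEq_lEP_rotor_iff hI hK]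
    exact ⟨forall_bodyBalance_iff I K hx.fst hx.snd, forall_rotorBalance_iff K hx.fst hx.snd⟩
  -- every equation is one of the two balances of momentum
  · refine fun J c hc => ⟨isAdmissibleOn_torusQuotientMap hc, fun t _ => ⟨fun α => ?_, fun β => ?_,
      fun α => ?_, fun β => ?_, ?_, forall_verticalEq_l₂_iff hI hK _ t⟩⟩
    · rw [verticalEq_l₁_iff hI hK, eulerPoincareEq_lEP_body_iff hI hK]
    · rw [horizontalEq_l₁_iff hI hK, eulerPoincareEq_lEP_rotor_iff hI hK]
    · rw [verticalEq_l₁_iff hI hK, verticalEq_l₂_body_iff hI hK]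
      rfl
    · rw [horizontalEq_l₁_iff hI hK, verticalEq_l₂_rotor_iff hI hK]
      rfl
    · simp only [verticalEq_l₁_iff hI hK, horizontalEq_l₁_iff hI hK,
        forall_eulerPoincareEq_lEP_iff hI hK]
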